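/- Let $\delta, D\in\mathbf N$ (with $0\in\mathbf N$). A connected graph is $\delta$-hyperbolic if for all vertices $u,v,w$, all geodesics $uv$, $vw$, $wu$ and every vertex $t$ on $uv$ there is a vertex on $vw\cup wu$ at distance at most $\delta$ from $t$. Let $G$ be a group with a finite generating set $A$ whose Cayley graph (taken as a simple graph, with $G$ acting by left translations) is $\delta$-hyperbolic, and let $d$ be the distance between vertices in this Cayley graph. Let $D\ge 8\delta+1$ and let the Rips complex $P_D(G)$ be the flag simplicial complex with vertex set $G$ in which two distinct vertices $g,g'$ span an edge if and only if $d(g,g')\le D$. 1. The geometric realisation of $P_D(G)$ (with the weak topology) is a finite model for $\underline{E}G$, the classifying space for proper actions of $G$. That is: it is a $G$-CW-complex with finitely many $G$-orbits of cells, and for every subgroup $H\le G$ the fixed point set $P_D(G)^H$ is contractible if $H$ is finite and empty if $H$ is infinite. 2. For every finite subgroup $H\le G$ and every finite set $S\subset G$ there is a finite $H$-invariant set $T\subset G$ with $S\subset T$ such that the subgraph of the $1$-skeleton of $P_D(G)$ induced on $T$ is dismantlable. If $S\neq\emptyset$, then $T$ can be taken to be a ball $B_r(C)=\{x\in G : d(x,c)\le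 r \text{ for some } c\in C\}$, for some $r\in\mathbf N$, around the quasi-centre $C$ of $HS=\{hs : h\in H,\ s\in S\}$. Here the quasi-centre of a nonempty finite set $O\subset G$ is $\{v\in G : d(v,x)\le R\text{ for all }x\in O\}$, where $R\in\mathbf N$ is the smallest number for which this set is nonempty. A nonempty finite graph is dismantlable if its vertices can be ordered as $\sigma_1,\dots,\sigma_m$ so that for each $i<m$ the vertex $\sigma_i$ is dominated in the subgraph induced on $\{\sigma_i,\dots,\sigma_m\}$; a vertex $\rho$ is dominated if there is a vertex $\pi\ne\rho$ such that $\rho$ and every neighbour of $\rho$ are equal or adjacent to $\pi$. -/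

import Mathlib

namespace RipsModel

/-! ### Hyperbolic graphs and dismantlable graphs -/

/-- A walk is a geodesic if its length is the distance between its endpoints. -/
def IsGeodesic {V : Type*} {Γ : SimpleGraph V} {u v : V} (p : Γ.Walk u v) : Prop :=
  p.length = Γ.dist u v

/-- Thin triangles, tested on vertices only. -/
def IsHyperbolicGraph {V : Type*} (Γ : SimpleGraph V) (δ : ℕ) : Prop :=
  ∀ (u v w : V) (p : Γ.Walk u v) (q : Γ.Walk v w) (r : Γ.Walk w u),
    IsGeodesic p → IsGeodesic q → IsGeodesic r →
      ∀ t ∈ p.support, ∃ t' : V, (t' ∈ q.support ∨ t' ∈ r.support) ∧ Γ.dist t t' ≤ δ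

/-- The vertex `ρ` is dominated, in the subgraph of `Γ` induced on `A`, by some vertex `π ≠ ρ`:
every vertex of `A` equal or adjacent to `ρ` is equal or adjacent to `π`. -/
def IsDominatedIn {V : Type*} (Γ : SimpleGraph V) (A : Set V) (ρ : V) : Prop :=
  ρ ∈ A ∧ ∃ π ∈ A, π ≠ ρ ∧ ∀ τ ∈ A, (τ = ρ ∨ Γ.Adj ρ τ) → (τ = π ∨ Γ.Adj π τ)

/-- The subgraph of `Γ` induced on `T` is a (nonempty, finite) dismantlable graph: the vertices
can be ordered as `σ 0, …, σ m` so that each vertex but the last is dominated in the subgraph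
induced on itself and the later ones. -/
def IsDismantlableOn {V : Type*} (Γ : SimpleGraph V) (T : Set V) : Prop :=
  ∃ (m : ℕ) (σ : Fin (m + 1) → V), Function.Injective σ ∧ Set.range σ = T ∧
    ∀ i : Fin (m + 1), i < Fin.last m → IsDominatedIn Γ (σ '' Set.Ici i) (σ i)

/-! ### Balls around sets and quasi-centres -/

/-- The vertices at distance at most `r` from some vertex of `C`. -/
def ballAround {V : Type*} (Γ : SimpleGraph V) (C : Set V) (r : ℕ) : Set V :=
  {x | ∃ c ∈ C, Γ.dist c x ≤ r}

/-- The least `R` such that `O` is contained in a ball of radius `R` around some vertex. -/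
noncomputable def circumradius {V : Type*} (Γ : SimpleGraph V) (O : Set V) : ℕ :=
  sInf {R : ℕ | ∃ v : V, ∀ x ∈ O, Γ.dist v x ≤ R}

/-- The set of centres of the balls of least radius containing `O`. -/
def quasiCentre {V : Type*} (Γ : SimpleGraph V) (O : Set V) : Set V :=
  {v | ∀ x ∈ O, Γ.dist v x ≤ circumradius Γ O}

/-! ### Simplicial complexes and their geometric realisations -/

/-- The flag complex of a graph: its simplices are the nonempty finite cliques. -/
def flagComplex {V : Type*} (Γ : SimpleGraph V) : AbstractSimplicialComplex V where
  faces := {s | s.Nonempty ∧ Γ.IsClique (s : Set V)}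
  isRelLowerSet_faces := fun _ hs =>
    ⟨hs.1, fun _ hts ht => ⟨ht, hs.2.subset (Finset.coe_subset.2 hts)⟩⟩
  singleton_mem := fun v => ⟨Finset.singleton_nonempty v, by simp⟩

/-- The geometric realisation, in barycentric coordinates: finitely supported functions with
nonnegative values of sum one, the support of which is a simplex. -/
def Realization {V : Type*} (K : AbstractSimplicialComplex V) : Type _ :=
  {x : V →₀ ℝ // x.support ∈ K.faces ∧ (∀ v, 0 ≤ x v) ∧ (x.sum fun _ a => a) = 1}

/-- The closed simplex of the geometric realisation spanned by `s`. -/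
def ClosedSimplex {V : Type*} (K : AbstractSimplicialComplex V) (s : Finset V) : Type _ :=
  {x : Realization K // x.1.support ⊆ s}

/-- The Euclidean topology of a closed simplex, in terms of barycentric coordinates. -/
instance {V : Type*} (K : AbstractSimplicialComplex V) (s : Finset V) :
    TopologicalSpace (ClosedSimplex K s) :=
  TopologicalSpace.induced (fun (x : ClosedSimplex K s) (v : V) => x.1.1 v)
    Pi.topologicalSpace

/-- The weak topology: a set is open if and only if its trace on every closed simplex is. -/
instance {V : Type*} (K : AbstractSimplicialComplex V) : TopologicalSpace (Realization K) :=
  ⨆ s : K.faces, TopologicalSpace.coinduced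
    (fun x : ClosedSimplex K s.1 => (x.1 : Realization K)) inferInstance

/-! ### The Rips complex of a group -/

section Rips

variable {G : Type*} [Group G]

/-- The `1`-skeleton of the Rips complex: distinct elements of `G` are adjacent if their
distance in the Cayley graph with respect to `S` is at most `D`. -/
def ripsGraph (S : Set G) (D : ℕ) : SimpleGraph G where
  Adj u v := u ≠ v ∧ (SimpleGraph.mulCayley S).dist u v ≤ D
  symm := ⟨fun _ _ h => ⟨h.1.symm, by rw [SimpleGraph.dist_comm]; exact h.2⟩⟩
  loopless := ⟨fun _ h => h.1 rfl⟩

/-- The Rips complex of `G` with respect to `S`. -/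
def ripsComplex (S : Set G) (D : ℕ) : AbstractSimplicialComplex G :=
  flagComplex (ripsGraph S D)

/-- Left translations preserve distances in the Cayley graph. -/
theorem dist_mul_left (S : Set G) (g u v : G) :
    (SimpleGraph.mulCayley S).dist (g * u) (g * v) = (SimpleGraph.mulCayley S).dist u v := by
  have key : ∀ a x y : G, (SimpleGraph.mulCayley S).edist (a * x) (a * y) ≤
      (SimpleGraph.mulCayley S).edist x y := by
    intro a x y
    refine le_iInf fun p => ?_
    let f : SimpleGraph.mulCayley S →g SimpleGraph.mulCayley S :=
      ⟨fun z => a * z, fun h => SimpleGraph.mulCayley_adj_mul_iff_right.2 h⟩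
    have := SimpleGraph.edist_le (p.map f)
    rwa [SimpleGraph.Walk.length_map] at this
  unfold SimpleGraph.dist
  congr 1
  refine le_antisymm (key g u v) ?_
  have := key g⁻¹ (g * u) (g * v)
  simpa using this

theorem map_mem_ripsComplex (S : Set G) (D : ℕ) (g : G) {s : Finset G}
    (hs : s ∈ (ripsComplex S D).faces) :
    s.map (Equiv.mulLeft g).toEmbedding ∈ (ripsComplex S D).faces := by
  refine ⟨hs.1.map, ?_⟩
  intro a ha b hb hab
  simp only [Finset.coe_map, Set.mem_image, Finset.mem_coe] at ha hb
  obtain ⟨x, hx, rfl⟩ := ha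
  obtain ⟨y, hy, rfl⟩ := hb
  refine ⟨hab, ?_⟩
  have hxy : x ≠ y := fun h => hab (by rw [h])
  have := (hs.2 hx hy hxy).2
  simpa [dist_mul_left] using this

/-- `G` acts on its Rips complex by left translations of the vertices: the coordinate of `g • x`
at `g * v` is the coordinate of `x` at `v`. -/
noncomputable instance (S : Set G) (D : ℕ) : MulAction G (Realization (ripsComplex S D)) where
  smul g x := ⟨Finsupp.equivMapDomain (Equiv.mulLeft g) x.1,
    map_mem_ripsComplex S D g x.2.1, fun v => x.2.2.1 _, by
      rw [Finsupp.sum_equivMapDomain]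
      exact x.2.2.2⟩
  one_smul x := by
    apply Subtype.ext
    refine Finsupp.ext fun v => ?_
    change x.1 (1⁻¹ * v) = x.1 v
    simp
  mul_smul g h x := by
    apply Subtype.ext
    refine Finsupp.ext fun v => ?_
    change x.1 ((g * h)⁻¹ * v) = x.1 (h⁻¹ * (g⁻¹ * v))
    simp [mul_assoc]

end Rips

/-! ### Classifying spaces for proper actions -/

/-- A CW structure on the `G`-space `X` is a `G`-CW structure (for the discrete group `G`) if `G`
permutes the open cells, and an element that maps a cell to itself fixes the cell pointwise. -/
def IsGCWStructure (G : Type*) {X : Type*} [Group G] [TopologicalSpace X] [MulAction G X]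
    (cw : Topology.CWComplex (Set.univ : Set X)) : Prop :=
  (∀ (g : G) (n : ℕ) (i : Topology.RelCWComplex.cell (Set.univ : Set X) n),
    ∃ j : Topology.RelCWComplex.cell (Set.univ : Set X) n,
      (fun x => g • x) '' Topology.RelCWComplex.openCell n i = Topology.RelCWComplex.openCell n j) ∧
  (∀ (g : G) (n : ℕ) (i : Topology.RelCWComplex.cell (Set.univ : Set X) n),
    (fun x => g • x) '' Topology.RelCWComplex.openCell n i = Topology.RelCWComplex.openCell n i →
      ∀ x ∈ Topology.RelCWComplex.openCell n i, g • x = x)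

/-- There are only finitely many `G`-orbits of cells. -/
def IsCofinite (G : Type*) {X : Type*} [Group G] [TopologicalSpace X] [MulAction G X]
    (cw : Topology.CWComplex (Set.univ : Set X)) : Prop :=
  ∃ F : Set (Σ n : ℕ, Topology.RelCWComplex.cell (Set.univ : Set X) n), F.Finite ∧
    ∀ (n : ℕ) (i : Topology.RelCWComplex.cell (Set.univ : Set X) n), ∃ c ∈ F, ∃ g : G,
      Topology.RelCWComplex.openCell n i =
        (fun x => g • x) '' Topology.RelCWComplex.openCell c.1 c.2

/-- The `G`-space `X` is a finite model for the classifying space for proper actions of the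
discrete group `G`: it is a `G`-CW-complex with finitely many orbits of cells, in which the fixed
point set of a subgroup `H` is contractible if `H` is finite and empty if `H` is infinite. -/
structure IsFiniteModelProperActions (G X : Type*) [Group G] [TopologicalSpace X]
    [MulAction G X] : Prop where
  continuous_smul : ContinuousConstSMul G X
  hausdorff : T2Space X
  exists_gcw : ∃ cw : Topology.CWComplex (Set.univ : Set X), IsGCWStructure G cw ∧ IsCofinite G cw
  contractible_fixedPoints : ∀ H : Subgroup G, Finite H →
    ContractibleSpace (MulAction.fixedPoints H X)
  fixedPoints_eq_empty : ∀ H : Subgroup G, Infinite H → MulAction.fixedPoints H X = ∅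

end RipsModel

namespace RipsModel

/-! ### Distances in hyperbolic graphs -/

section Metric

variable {V : Type*} {Γ : SimpleGraph V}

/-! Let `C` be the quasi-centre of a nonempty finite set that is invariant under a finite subgroup
`H`. A midpoint argument in thin triangles bounds the diameter of `C` by `4 * δ + 1 ≤ D`
(`dist_le_of_mem_quasiCentre`), so `C` spans a simplex of the Rips complex. Let `B_r` be the ball of
radius `r` around `C`. A vertex of `B_{r+1}` outside `B_r`, moved about `2 * δ` back towards `C`,
gives a vertex of `B_r` that dominates it in `B_{r+1}` (`exists_dominating_mem_ballAround`). Hence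
all `B_r` are dismantlable. They are finite and `H`-invariant and exhaust `G`, which gives the
second claim.

For the contractibility of fixed point sets, the finite invariant set is `H` itself. Sending each
new vertex of `B_{r+1}` to the barycentre of all its dominators in `B_r` involves no choice, so this
retraction commutes with `H`; as the complex is flag, the retraction is joined to the identity by
segments inside the complex. Each vertex is moved by finitely many of these retractions only, so all
of them can be concatenated within the unit interval (`contractibleSpace_of_dominators`). An
infinite subgroup has no fixed points, because it acts freely on the vertices and supports are
finite.

An element of `G` can permute the vertices of a simplex that it preserves, so the simplices
themselves are not the cells of a `G`-CW structure. The cells used are those of the barycentric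
subdivision, indexed by chains of faces (`subdivisionCW`). The members of a chain have distinct
cardinalities, so an element preserving the chain fixes every barycentre. Each chain has a translate
all of whose members contain `1` and so lie in the finite ball of radius `D`, which leaves finitely
many orbits. -/

theorem exists_dist_eq_of_le_dist (hΓ : Γ.Connected) {u v : V} {k : ℕ} (hk : k ≤ Γ.dist u v) :
    ∃ t, Γ.dist u t = k ∧ k + Γ.dist t v = Γ.dist u v := by
  obtain ⟨p, hp⟩ := hΓ.exists_walk_length_eq_dist u v
  have h1 : Γ.dist u (p.getVert k) ≤ k := by
    refine (SimpleGraph.dist_le (p.take k)).trans ?_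
    simp [SimpleGraph.Walk.take_length]
  have h2 : Γ.dist (p.getVert k) v ≤ Γ.dist u v - k := by
    refine (SimpleGraph.dist_le (p.drop k)).trans ?_
    simp [SimpleGraph.Walk.drop_length, hp]
  have h3 : Γ.dist u v ≤ Γ.dist u (p.getVert k) + Γ.dist (p.getVert k) v := hΓ.dist_triangle
  exact ⟨p.getVert k, by omega, by omega⟩

theorem IsGeodesic.dist_add_dist (hΓ : Γ.Connected) {u v t : V} {p : Γ.Walk u v}
    (hp : IsGeodesic p) (ht : t ∈ p.support) : Γ.dist u t + Γ.dist t v = Γ.dist u v := by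
  classical
  have h1 := SimpleGraph.dist_le (p.takeUntil t ht)
  have h2 := SimpleGraph.dist_le (p.dropUntil t ht)
  have h3 : Γ.dist u v ≤ Γ.dist u t + Γ.dist t v := hΓ.dist_triangle
  have h4 := congrArg SimpleGraph.Walk.length (p.take_spec ht)
  rw [SimpleGraph.Walk.length_append] at h4
  have h5 : p.length = Γ.dist u v := hp
  omega

/-- Lying on a geodesic is encoded as equality in the triangle inequality, which turns the later
uses of thin triangles into linear arithmetic. Any such `t` lies on a concatenation of two geodesics
that is again geodesic. -/
theorem IsHyperbolicGraph.exists_dist_le (hΓ : Γ.Connected) {δ : ℕ} (hδ : IsHyperbolicGraph Γ δ)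
    {u v t : V} (w : V) (ht : Γ.dist u t + Γ.dist t v = Γ.dist u v) :
    ∃ t', (Γ.dist v t' + Γ.dist t' w = Γ.dist v w ∨ Γ.dist u t' + Γ.dist t' w = Γ.dist u w) ∧
      Γ.dist t t' ≤ δ := by
  obtain ⟨p₁, hp₁⟩ := hΓ.exists_walk_length_eq_dist u t
  obtain ⟨p₂, hp₂⟩ := hΓ.exists_walk_length_eq_dist t v
  obtain ⟨q, hq⟩ := hΓ.exists_walk_length_eq_dist v w
  obtain ⟨r, hr⟩ := hΓ.exists_walk_length_eq_dist w u
  obtain ⟨t', h, h'⟩ := hδ u v w (p₁.append p₂) q r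
    (by rw [IsGeodesic, SimpleGraph.Walk.length_append, hp₁, hp₂, ht]) hq hr t
    (by simp)
  refine ⟨t', h.imp (IsGeodesic.dist_add_dist hΓ hq) fun h => ?_, h'⟩
  have := IsGeodesic.dist_add_dist hΓ hr h
  rw [Γ.dist_comm (u := u) (v := t'), Γ.dist_comm (u := t') (v := w), Γ.dist_comm (u := u) (v := w)]
  omega

theorem quasiCentre_nonempty [Nonempty V] {O : Set V} (hO : O.Finite) :
    (quasiCentre Γ O).Nonempty := by
  obtain ⟨v⟩ := ‹Nonempty V›
  obtain ⟨R, hR⟩ := (hO.image (Γ.dist v)).bddAbove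
  exact Nat.sInf_mem (s := {R : ℕ | ∃ v : V, ∀ x ∈ O, Γ.dist v x ≤ R})
    ⟨R, v, fun x hx => hR ⟨x, hx, rfl⟩⟩

/-- If `v` and `w` were at distance at least `4 * δ + 2`, their midpoint `m` would be at distance at
least `2 * δ + 1` from both. For `x ∈ O`, a point `δ`-close to `m` on a side ending in `x` is at
least `δ + 1` away from `v` or `w`, so `m` is nearer to `x` than the circumradius, which contradicts
minimality. -/
theorem dist_le_of_mem_quasiCentre (hΓ : Γ.Connected) {δ : ℕ} (hδ : IsHyperbolicGraph Γ δ)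
    {O : Set V} (hO : O.Nonempty) {v w : V} (hv : v ∈ quasiCentre Γ O)
    (hw : w ∈ quasiCentre Γ O) : Γ.dist v w ≤ 4 * δ + 1 := by
  by_contra! hlt
  obtain ⟨m, hm, hm'⟩ := exists_dist_eq_of_le_dist hΓ (Nat.div_le_self (Γ.dist v w) 2)
  have key : ∀ x ∈ O, Γ.dist m x + 1 ≤ circumradius Γ O := by
    intro x hx
    obtain ⟨t, ht, htδ⟩ := hδ.exists_dist_le hΓ x (u := v) (v := w) (t := m) (by omega)
    have h1 : Γ.dist m x ≤ Γ.dist m t + Γ.dist t x := hΓ.dist_triangle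
    have h2 : Γ.dist v m ≤ Γ.dist v t + Γ.dist t m := hΓ.dist_triangle
    have h3 : Γ.dist w m ≤ Γ.dist w t + Γ.dist t m := hΓ.dist_triangle
    have h4 := hv x hx
    have h5 := hw x hx
    rw [Γ.dist_comm (u := t) (v := m)] at h2 h3
    rw [Γ.dist_comm (u := w) (v := m)] at h3
    omega
  -- A point of `O` shows that the circumradius is positive, so that the truncated subtraction below
  -- is a genuine one.
  obtain ⟨x, hx⟩ := hO
  have h0 := key x hx
  have : circumradius Γ O ≤ circumradius Γ O - 1 :=
    Nat.sInf_le ⟨m, fun x hx => by have := key x hx; omega⟩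
  omega

theorem ballAround_mono (C : Set V) : Monotone (ballAround Γ C) :=
  fun _ _ h _ ⟨c, hc, hx⟩ => ⟨c, hc, hx.trans h⟩

/-- The vertex `π` is taken on a geodesic from a nearest `c ∈ C` to `ρ`, at distance `k` from `ρ`.
The triangle `c`, `ρ`, `σ` is thin at `π`: a nearby point on `ρσ` bounds the distance from `π` to
`σ` by `D + 2 * δ - k`, one on `cσ` by `6 * δ + 1 + k`. Both are at most `D` for `k = 2 * δ`. -/
theorem exists_dominating_mem_ballAround (hΓ : Γ.Connected) {δ D : ℕ}
    (hδ : IsHyperbolicGraph Γ δ) (hD : 8 * δ + 1 ≤ D) {C : Set V}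
    (hC : ∀ c ∈ C, ∀ c' ∈ C, Γ.dist c c' ≤ 4 * δ + 1) {r : ℕ} {ρ : V}
    (hρ : ρ ∈ ballAround Γ C (r + 1)) (hρ' : ρ ∉ ballAround Γ C r) :
    ∃ π ∈ ballAround Γ C r, ∀ σ ∈ ballAround Γ C (r + 1), Γ.dist ρ σ ≤ D → Γ.dist π σ ≤ D := by
  have far : ∀ c ∈ C, r + 1 ≤ Γ.dist c ρ := by
    intro c hc
    by_contra! h
    exact hρ' ⟨c, hc, by omega⟩
  obtain ⟨c, hc, hcρ⟩ := hρ
  have hcρ' : Γ.dist c ρ = r + 1 := le_antisymm hcρ (far c hc)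
  -- The ideal value `2 * δ` is cut off at `r + 1`, where `π = c`, and raised to `1` if `δ = 0`,
  -- since `π` has to leave the sphere.
  obtain ⟨k, hk1, hkr, hk⟩ : ∃ k, 1 ≤ k ∧ k ≤ r + 1 ∧
      (k = 2 * δ ∨ (k = r + 1 ∧ k ≤ 2 * δ) ∨ (k = 1 ∧ δ = 0)) := by
    by_cases h0 : δ = 0
    · exact ⟨1, le_rfl, by omega, by omega⟩
    · exact ⟨min (2 * δ) (r + 1), by omega, by omega, by omega⟩
  obtain ⟨π, hπ, hπ'⟩ := exists_dist_eq_of_le_dist hΓ (u := c) (v := ρ) (k := r + 1 - k) (by omega)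
  refine ⟨π, ⟨c, hc, by omega⟩, fun σ ⟨c', hc', hσ⟩ hρσ => ?_⟩
  have hcc' := hC c hc c' hc'
  have hcσ : Γ.dist c σ ≤ Γ.dist c c' + Γ.dist c' σ := hΓ.dist_triangle
  obtain ⟨t, ht, htδ⟩ := hδ.exists_dist_le hΓ σ (u := c) (v := ρ) (t := π) (by omega)
  have h1 : Γ.dist π σ ≤ Γ.dist π t + Γ.dist t σ := hΓ.dist_triangle
  have h2 : Γ.dist ρ π ≤ Γ.dist ρ t + Γ.dist t π := hΓ.dist_triangle
  have h3 : Γ.dist c π ≤ Γ.dist c t + Γ.dist t π := hΓ.dist_triangle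
  rw [Γ.dist_comm (u := t) (v := π)] at h2 h3
  rw [Γ.dist_comm (u := ρ) (v := π)] at h2
  rcases ht with ht | ht
  · rcases hk with hk | hk | hk
    · omega
    · have h4 : Γ.dist π σ ≤ Γ.dist π c + Γ.dist c σ := hΓ.dist_triangle
      rw [Γ.dist_comm (u := π) (v := c)] at h4
      omega
    · omega
  · rcases hk with hk | hk | ⟨rfl, rfl⟩
    · omega
    · omega
    -- for `δ = 0` and `D = 1` a second triangle is needed
    by_contra! hlt
    have e1 : Γ.dist c c' = 1 := by omega
    have e2 : Γ.dist c σ = r + 2 := by omega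
    have e3 : Γ.dist ρ σ = 1 := by
      have : Γ.dist c σ ≤ Γ.dist c ρ + Γ.dist ρ σ := hΓ.dist_triangle
      omega
    obtain ⟨s, hs, hsδ⟩ := hδ.exists_dist_le hΓ c' (u := c) (v := σ) (t := ρ) (by omega)
    obtain rfl : ρ = s := hΓ.dist_eq_zero_iff.1 (by omega)
    have h5 := far c' hc'
    rw [Γ.dist_comm (u := c')] at h5
    rw [Γ.dist_comm (u := σ) (v := ρ), Γ.dist_comm (u := σ) (v := c')] at hs
    omega

end Metric

/-! ### Dismantlable graphs -/

section Dismantlable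

variable {V : Type*} {Γ : SimpleGraph V}

theorem isDismantlableOn_singleton (v : V) : IsDismantlableOn Γ {v} :=
  ⟨0, fun _ => v, fun i j _ => by omega, by simp, fun i hi => by
    have := Fin.lt_def.1 hi
    simp at this⟩

/-- The new vertex is put first in the ordering, so the induced subgraphs on the remaining tails are
unchanged. -/
theorem IsDismantlableOn.insert_of_isDominatedIn {T : Set V} (hT : IsDismantlableOn Γ T) {ρ : V}
    (hρ : ρ ∉ T) (h : IsDominatedIn Γ (insert ρ T) ρ) : IsDismantlableOn Γ (insert ρ T) := by
  obtain ⟨m, σ, hσ, rfl, hdom⟩ := hT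
  refine ⟨m + 1, Fin.cons ρ σ, Fin.cons_injective_iff.2 ⟨hρ, hσ⟩, by simp [Fin.range_cons], ?_⟩
  intro i hi
  induction i using Fin.cases with
  | zero =>
    have : Set.Ici (0 : Fin (m + 1 + 1)) = Set.univ := by ext; simp
    rw [this, Set.image_univ, Fin.range_cons]
    simpa using h
  | succ i =>
    have hi' : i < Fin.last m := by
      rw [← Fin.succ_last, Fin.succ_lt_succ_iff] at hi
      exact hi
    have : (Fin.cons ρ σ : Fin (m + 1 + 1) → V) '' Set.Ici i.succ = σ '' Set.Ici i := by
      ext x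
      constructor
      · rintro ⟨j, hj, rfl⟩
        induction j using Fin.cases with
        | zero => simp at hj
        | succ j => exact ⟨j, by simpa using hj, by simp⟩
      · rintro ⟨j, hj, rfl⟩
        exact ⟨j.succ, by simpa using hj, by simp⟩
    rw [this, Fin.cons_succ]
    exact hdom i hi'

/-- If every vertex of `T'` outside of the dismantlable set `T` is dominated in `T'` by a vertex
of `T`, then `T'` is dismantlable. -/
theorem IsDismantlableOn.of_subset {T T' : Set V} (hT : IsDismantlableOn Γ T) (hTT' : T ⊆ T')
    (hfin : T'.Finite)
    (h : ∀ ρ ∈ T', ρ ∉ T → ∃ π ∈ T, ∀ σ ∈ T', (σ = ρ ∨ Γ.Adj ρ σ) → (σ = π ∨ Γ.Adj π σ)) :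
    IsDismantlableOn Γ T' := by
  -- The order of insertion is irrelevant: the dominating vertices lie in `T`, which is present at
  -- every stage, and domination within `T'` restricts to smaller sets.
  have key : ∀ F : Set V, F.Finite → F ⊆ T' \ T → IsDismantlableOn Γ (T ∪ F) := by
    intro F hF
    induction F, hF using Set.Finite.induction_on with
    | empty => intro _; simpa using hT
    | @insert ρ F hρF hF ih =>
      intro hsub
      have hsub' := (Set.subset_insert ρ F).trans hsub
      have hρ := hsub (Set.mem_insert ρ F)
      obtain ⟨π, hπ, hdom⟩ := h ρ hρ.1 hρ.2
      have hle : insert ρ (T ∪ F) ⊆ T' := Set.insert_subset hρ.1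
        (Set.union_subset hTT' (hsub'.trans Set.sdiff_subset))
      rw [Set.union_insert]
      refine (ih hsub').insert_of_isDominatedIn (fun h => h.elim hρ.2 hρF) ⟨Set.mem_insert _ _, π,
        Or.inr (Or.inl hπ), fun e => hρ.2 (e ▸ hπ), fun τ hτ => hdom τ (hle hτ)⟩
  simpa [Set.union_sdiff_cancel hTT'] using key (T' \ T) (hfin.subset Set.sdiff_subset) le_rfl

end Dismantlable

/-! ### The topology of geometric realisations -/

section Topology

open Topology

variable {V : Type*} {K : AbstractSimplicialComplex V}

theorem isClosed_realization_iff {A : Set (Realization K)} :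
    IsClosed A ↔ ∀ s ∈ K.faces, IsClosed {x : ClosedSimplex K s | x.1 ∈ A} := by
  change IsClosed[⨆ s : K.faces, _] A ↔ _
  simp only [isClosed_iSup_iff, isClosed_coinduced, Subtype.forall]
  rfl

theorem continuous_realization_iff {Y : Type*} [TopologicalSpace Y] {f : Realization K → Y} :
    Continuous f ↔ ∀ s ∈ K.faces, Continuous fun x : ClosedSimplex K s => f x.1 := by
  change Continuous[⨆ s : K.faces, _, _] f ↔ _
  simp only [continuous_iSup_dom, continuous_coinduced_dom, Subtype.forall]
  rfl

theorem isInducing_closedSimplex (s : Finset V) :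
    IsInducing (fun (x : ClosedSimplex K s) (v : V) => x.1.1 v) := ⟨rfl⟩

theorem continuous_closedSimplex_apply (s : Finset V) (v : V) :
    Continuous fun x : ClosedSimplex K s => x.1.1 v :=
  (continuous_apply v).comp (isInducing_closedSimplex s).continuous

theorem continuous_realization_apply (v : V) : Continuous fun x : Realization K => x.1 v :=
  continuous_realization_iff.2 fun s _ => continuous_closedSimplex_apply s v

theorem Realization.ext_apply {x y : Realization K} (h : ∀ v, x.1 v = y.1 v) : x = y :=
  Subtype.ext (Finsupp.ext h)

theorem Realization.sum_eq_one (x : Realization K) {s : Finset V} (h : x.1.support ⊆ s) :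
    ∑ v ∈ s, x.1 v = 1 := by
  exact (Finsupp.sum_of_support_subset x.1 h _ (by simp)).symm.trans x.2.2.2

theorem Realization.apply_eq_zero (x : Realization K) {s : Finset V} (h : x.1.support ⊆ s) {v : V}
    (hv : v ∉ s) : x.1 v = 0 :=
  Finsupp.notMem_support_iff.1 fun hv' => hv (h hv')

instance : T2Space (Realization K) := by
  refine ⟨fun x y hxy => ?_⟩
  obtain ⟨v, hv⟩ : ∃ v, x.1 v ≠ y.1 v := by
    by_contra! h
    exact hxy (Realization.ext_apply h)
  obtain ⟨U, W, hU, hW, hx, hy, hd⟩ := t2_separation hv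
  exact ⟨_, _, hU.preimage (continuous_realization_apply v),
    hW.preimage (continuous_realization_apply v), hx, hy, hd.preimage _⟩

theorem compactSpace_closedSimplex {s : Finset V} (hs : s ∈ K.faces) :
    CompactSpace (ClosedSimplex K s) := by
  classical
  rw [← isCompact_univ_iff, (isInducing_closedSimplex s).isCompact_iff, Set.image_univ]
  have hrange : Set.range (fun (x : ClosedSimplex K s) (v : V) => x.1.1 v) =
      Set.pi Set.univ (fun _ => Set.Icc (0 : ℝ) 1) ∩
        ({x | ∀ v, v ∉ s → x v = 0} ∩ {x | ∑ v ∈ s, x v = 1}) := by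
    ext x
    constructor
    · rintro ⟨y, rfl⟩
      have hsum := y.1.sum_eq_one y.2
      refine ⟨fun v _ => ⟨y.1.2.2.1 v, ?_⟩, fun v hv => y.1.apply_eq_zero y.2 hv, hsum⟩
      by_cases hv : v ∈ s
      · exact (Finset.single_le_sum (f := fun v => y.1.1 v) (fun w _ => y.1.2.2.1 w) hv).trans_eq
          hsum
      · exact (y.1.apply_eq_zero y.2 hv).trans_le zero_le_one
    · rintro ⟨h1, h2, h3⟩
      let z : V →₀ ℝ := Finsupp.onFinset s x fun v hv => by
        by_contra h
        exact hv (h2 v h)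
      have hz : z.support ⊆ s := Finsupp.support_onFinset_subset
      have hsum : (z.sum fun _ a => a) = 1 := by
        rw [Finsupp.sum_of_support_subset z hz _ (by simp)]
        exact h3
      refine ⟨⟨⟨z, (K.isRelLowerSet_faces hs).2 hz ?_, fun v => (h1 v trivial).1, hsum⟩, hz⟩, rfl⟩
      rw [Finset.nonempty_iff_ne_empty]
      rintro h0
      rw [Finsupp.support_eq_empty.1 h0] at hsum
      simp at hsum
  rw [hrange]
  refine (isCompact_univ_pi fun _ => isCompact_Icc).inter_right (IsClosed.inter ?_ ?_)
  · simp only [Set.ofPred_forall]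
    exact isClosed_iInter fun v => isClosed_iInter fun _ =>
      isClosed_eq (continuous_apply v) continuous_const
  · exact isClosed_eq (continuous_finsetSum _ fun v _ => continuous_apply v) continuous_const

/-- A map into a finite subcomplex is continuous if its coordinates are. -/
theorem continuous_of_support_subset {Y : Type*} [TopologicalSpace Y] {F : Y → Realization K}
    (W : Finset V) (hW : ∀ y, (F y).1.support ⊆ W) (hF : ∀ v, Continuous fun y => (F y).1 v) :
    Continuous F := by
  classical
  refine continuous_iff_isClosed.2 fun A hA => ?_
  -- Only finitely many faces lie in `W`. On each of them the closed simplex is compact, so the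
  -- trace of `A` has a closed image in the product of the coordinate lines.
  have hcover : F ⁻¹' A = ⋃ s ∈ {s | s ∈ W.powerset ∧ s ∈ K.faces},
      {y | F y ∈ A ∧ (F y).1.support ⊆ s} := by
    ext y
    simp only [Set.mem_preimage, Set.mem_iUnion, Set.mem_ofPred_eq, Finset.mem_powerset]
    exact ⟨fun h => ⟨_, ⟨hW y, (F y).2.1⟩, h, subset_rfl⟩, fun ⟨_, _, h, _⟩ => h⟩
  rw [hcover]
  refine Set.Finite.isClosed_biUnion
    (W.powerset.finite_toSet.subset fun s hs => hs.1) fun s hs => ?_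
  have := compactSpace_closedSimplex hs.2
  have hc : IsClosed ((fun (x : ClosedSimplex K s) (v : V) => x.1.1 v) ''
      {x : ClosedSimplex K s | x.1 ∈ A}) :=
    ((isClosed_realization_iff.1 hA s hs.2).isCompact.image
      (isInducing_closedSimplex s).continuous).isClosed
  convert hc.preimage (continuous_pi hF) using 1
  ext y
  constructor
  · rintro ⟨h1, h2⟩
    exact ⟨⟨F y, h2⟩, h1, rfl⟩
  · rintro ⟨x, hx, hxy⟩
    have : x.1 = F y := Realization.ext_apply fun v => congrFun hxy v
    exact ⟨this ▸ hx, this ▸ x.2⟩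

end Topology

/-! ### Points of geometric realisations -/

section Points

variable {V : Type*} {K : AbstractSimplicialComplex V}

/-- Barycentric coordinates of a point of the geometric realisation. -/
def IsPoint (K : AbstractSimplicialComplex V) (x : V →₀ ℝ) : Prop :=
  x.support ∈ K.faces ∧ (∀ v, 0 ≤ x v) ∧ (x.sum fun _ a => a) = 1

theorem isPoint_of_support_subset {x : V →₀ ℝ} {s : Finset V} (hs : s ∈ K.faces)
    (hx : x.support ⊆ s) (h0 : ∀ v, 0 ≤ x v) (h1 : (x.sum fun _ a => a) = 1) : IsPoint K x := by
  refine ⟨(K.isRelLowerSet_faces hs).2 hx ?_, h0, h1⟩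
  rw [Finset.nonempty_iff_ne_empty]
  intro h
  rw [Finsupp.support_eq_empty.1 h] at h1
  simp at h1

/-- The sum of the coordinates, as a linear form. -/
noncomputable def coordSum (V : Type*) : (V →₀ ℝ) →ₗ[ℝ] ℝ :=
  Finsupp.linearCombination ℝ fun _ => 1

theorem coordSum_apply (x : V →₀ ℝ) : coordSum V x = x.sum fun _ a => a := by
  simp [coordSum, Finsupp.linearCombination_apply]

theorem coordSum_single (v : V) (a : ℝ) : coordSum V (Finsupp.single v a) = a := by
  simp [coordSum]

theorem coordSum_linearCombination {k : V → V →₀ ℝ} {y : V →₀ ℝ}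
    (hk : ∀ v ∈ y.support, coordSum V (k v) = 1) :
    coordSum V (Finsupp.linearCombination ℝ k y) = coordSum V y := by
  rw [Finsupp.linearCombination_apply, map_finsuppSum, coordSum_apply]
  exact Finset.sum_congr rfl fun v hv => by simp [hk v hv]

theorem linearCombination_nonneg {k : V → V →₀ ℝ} {y : V →₀ ℝ}
    (hk : ∀ v ∈ y.support, ∀ w, 0 ≤ k v w) (hy : ∀ v, 0 ≤ y v) (w : V) :
    0 ≤ Finsupp.linearCombination ℝ k y w := by
  rw [Finsupp.linearCombination_apply, Finsupp.sum, Finsupp.finsetSum_apply]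
  exact Finset.sum_nonneg fun v hv => mul_nonneg (hy v) (hk v hv w)

theorem support_linearCombination_subset {k : V → V →₀ ℝ} {y : V →₀ ℝ} {s : Finset V}
    (hk : ∀ v ∈ y.support, (k v).support ⊆ s) :
    (Finsupp.linearCombination ℝ k y).support ⊆ s := by
  intro w hw
  by_contra hws
  refine Finsupp.mem_support_iff.1 hw ?_
  rw [Finsupp.linearCombination_apply, Finsupp.sum, Finsupp.finsetSum_apply]
  refine Finset.sum_eq_zero fun v hv => ?_
  rw [Finsupp.smul_apply, Finsupp.notMem_support_iff.1 fun h => hws (hk v hv h), smul_zero]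

theorem isPoint_lineMap_linearCombination {k : V → V →₀ ℝ} {y : V →₀ ℝ} {s : Finset V}
    (hs : s ∈ K.faces) (hy : IsPoint K y) (hys : y.support ⊆ s)
    (hks : ∀ v ∈ y.support, (k v).support ⊆ s) (hk0 : ∀ v ∈ y.support, ∀ w, 0 ≤ k v w)
    (hk1 : ∀ v ∈ y.support, coordSum V (k v) = 1) {a : ℝ} (ha : a ∈ Set.Icc (0 : ℝ) 1) :
    IsPoint K ((1 - a) • Finsupp.linearCombination ℝ k y + a • y) := by
  classical
  refine isPoint_of_support_subset hs ?_ (fun v => ?_) ?_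
  · exact Finsupp.support_add.trans (Finset.union_subset
      (Finsupp.support_smul.trans (support_linearCombination_subset hks))
      (Finsupp.support_smul.trans hys))
  · exact add_nonneg (mul_nonneg (by linarith [ha.2]) (linearCombination_nonneg hk0 hy.2.1 v))
      (mul_nonneg ha.1 (hy.2.1 v))
  · have h1 : coordSum V y = 1 := (coordSum_apply y).trans hy.2.2
    rw [← coordSum_apply, map_add, map_smul, map_smul, coordSum_linearCombination hk1, h1]
    simp

/-- The barycentre of a finite set of vertices. -/
noncomputable def barycentre (s : Finset V) : V →₀ ℝ :=
  ∑ v ∈ s, Finsupp.single v (s.card : ℝ)⁻¹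

open Classical in
theorem barycentre_apply (s : Finset V) (v : V) :
    barycentre s v = if v ∈ s then (s.card : ℝ)⁻¹ else 0 := by
  simp [barycentre, Finsupp.finsetSum_apply, Finsupp.single_apply]

theorem barycentre_nonneg (s : Finset V) (v : V) : 0 ≤ barycentre s v := by
  classical
  rw [barycentre_apply]
  positivity

theorem support_barycentre_subset (s : Finset V) : (barycentre s).support ⊆ s := by
  classical
  intro v hv
  by_contra h
  exact Finsupp.mem_support_iff.1 hv (by rw [barycentre_apply, if_neg h])

theorem coordSum_barycentre {s : Finset V} (hs : s.Nonempty) : coordSum V (barycentre s) = 1 := by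
  have : (s.card : ℝ) ≠ 0 := by exact_mod_cast hs.card_pos.ne'
  simp [barycentre, coordSum_single, this]

theorem isPoint_barycentre {s : Finset V} (hs : s ∈ K.faces) : IsPoint K (barycentre s) :=
  isPoint_of_support_subset hs (support_barycentre_subset s) (barycentre_nonneg s)
    ((coordSum_apply _).symm.trans (coordSum_barycentre (K.isRelLowerSet_faces hs).1))

theorem lmapDomain_barycentre (e : V ≃ V) (s : Finset V) :
    Finsupp.lmapDomain ℝ ℝ e (barycentre s) = barycentre (s.map e.toEmbedding) := by
  simp [barycentre, Finsupp.mapDomain_single, map_sum]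

end Points

/-! ### Concatenating infinitely many linear homotopies -/

section Contraction

open Topology unitInterval

variable {V : Type*} {K : AbstractSimplicialComplex V}

/-- The function that decreases linearly from `1` to `0` on `[1 / (r + 2), 1 / (r + 1)]`. -/
noncomputable def ramp (r : ℕ) (u : ℝ) : ℝ := max 0 (min 1 ((r + 2) * (1 - (r + 1) * u)))

theorem continuous_ramp (r : ℕ) : Continuous (ramp r) := by
  unfold ramp
  fun_prop

theorem ramp_mem_Icc (r : ℕ) (u : ℝ) : ramp r u ∈ Set.Icc (0 : ℝ) 1 :=
  ⟨le_max_left _ _, max_le zero_le_one (min_le_left _ _)⟩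

theorem ramp_zero (r : ℕ) : ramp r 0 = 1 := by
  have : (1 : ℝ) ≤ r + 2 := by linarith [(Nat.cast_nonneg r : (0 : ℝ) ≤ r)]
  simp [ramp, min_eq_left this]

theorem ramp_one (r : ℕ) : ramp r 1 = 0 := by
  have : ((r : ℝ) + 2) * (1 - (r + 1) * 1) ≤ 0 := by
    nlinarith [(Nat.cast_nonneg r : (0 : ℝ) ≤ r)]
  exact max_eq_left ((min_le_right _ _).trans this)

/-- A value other than `1` means `u > 1 / (r + 2) ≥ 1 / (r' + 1)`, beyond the support of `ramp r'`.
So at most one step is in progress at any time. -/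
theorem ramp_eq_zero_of_lt {r r' : ℕ} {u : ℝ} (hr : ramp r u ≠ 1) (hrr' : r < r') :
    ramp r' u = 0 := by
  have h0 : (0 : ℝ) ≤ r := Nat.cast_nonneg r
  have h1 : (r : ℝ) + 1 ≤ r' := by exact_mod_cast hrr'
  have hlt : ((r : ℝ) + 2) * (1 - (r + 1) * u) < 1 := by
    by_contra! h
    exact hr (by simp [ramp, min_eq_left h])
  have hu : 1 < ((r : ℝ) + 2) * u := by
    by_contra! h
    nlinarith
  have hu0 : 0 < u := by
    by_contra! h
    nlinarith
  have : ((r' : ℝ) + 2) * (1 - (r' + 1) * u) ≤ 0 := by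
    refine mul_nonpos_of_nonneg_of_nonpos (by linarith) ?_
    nlinarith
  exact max_eq_left ((min_le_right _ _).trans this)

theorem exists_sum_ramp_eq {E : Type*} [AddCommGroup E] [Module ℝ E] (q : ℕ → E) (u : ℝ) (N : ℕ) :
    ∃ m, ∃ a ∈ Set.Icc (0 : ℝ) 1,
      q 0 + ∑ r ∈ Finset.range N, ramp r u • (q (r + 1) - q r) = (1 - a) • q m + a • q (m + 1) := by
  -- The invariant is that either all weights so far are `1` and the sum has telescoped to `q N`, or
  -- a segment has been reached and all further weights vanish.
  suffices h : q 0 + ∑ r ∈ Finset.range N, ramp r u • (q (r + 1) - q r) = q N ∨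
      (∃ m, ∃ a ∈ Set.Icc (0 : ℝ) 1, q 0 + ∑ r ∈ Finset.range N, ramp r u • (q (r + 1) - q r) =
        (1 - a) • q m + a • q (m + 1)) ∧ ∀ r, N ≤ r → ramp r u = 0 by
    rcases h with h | h
    · exact ⟨N, 0, by simp, by simp [h]⟩
    · exact h.1
  induction N with
  | zero => left; simp
  | succ N ih =>
    rw [Finset.sum_range_succ, ← add_assoc]
    rcases ih with ih | ⟨⟨m, a, ha, h⟩, ih⟩
    · rw [ih]
      by_cases h1 : ramp N u = 1
      · left
        simp [h1]
      · right
        exact ⟨⟨N, ramp N u, ramp_mem_Icc N u, by module⟩,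
          fun r hr => ramp_eq_zero_of_lt h1 hr⟩
    · right
      exact ⟨⟨m, a, ha, by simp [h, ih N le_rfl]⟩, fun r hr => ih r (by omega)⟩

/-- The weak topology is a colimit, and products with a locally compact space respect it: after
currying into `C(Y, Z)`, continuity is tested on closed simplices. -/
theorem continuous_realization_prod {Y Z : Type*} [TopologicalSpace Y] [LocallyCompactSpace Y]
    [TopologicalSpace Z] {f : Realization K → Y → Z}
    (hf : ∀ s ∈ K.faces, Continuous fun p : ClosedSimplex K s × Y => f p.1.1 p.2) :
    Continuous fun p : Realization K × Y => f p.1 p.2 := by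
  have hf' : ∀ x, Continuous (f x) := by
    intro x
    have hc : Continuous fun y : Y =>
        (((⟨x, subset_rfl⟩ : ClosedSimplex K x.1.support), y) : ClosedSimplex K x.1.support × Y) :=
      continuous_const.prodMk continuous_id
    exact (hf _ x.2.1).comp hc
  have hcont : Continuous fun x => (⟨f x, hf' x⟩ : C(Y, Z)) :=
    continuous_realization_iff.2 fun s hs =>
      ContinuousMap.continuous_of_continuous_uncurry _ (hf s hs)
  exact ContinuousMap.continuous_uncurry_of_continuous ⟨_, hcont⟩

/-- A homotopy that is linear on each simplex, given by the tracks `fun u => ψ u v` of the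
vertices, contracts each set that it preserves and that contains its endpoint. -/
theorem contractibleSpace_of_linear_homotopy (ψ : ℝ → V → V →₀ ℝ) (β : Realization K)
    (hpt : ∀ (u : ℝ) (x : Realization K), IsPoint K (Finsupp.linearCombination ℝ (ψ u) x.1))
    (W : V → Finset V) (hW : ∀ u v, (ψ u v).support ⊆ W v)
    (hcont : ∀ v w, Continuous fun u => ψ u v w)
    (h0 : ∀ v, ψ 0 v = Finsupp.single v 1)
    (h1 : ∀ x : Realization K, Finsupp.linearCombination ℝ (ψ 1) x.1 = β.1)
    (F : Set (Realization K)) (hβ : β ∈ F)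
    (hF : ∀ x ∈ F, ∀ (y : Realization K) (u : ℝ),
      y.1 = Finsupp.linearCombination ℝ (ψ u) x.1 → y ∈ F) :
    ContractibleSpace F := by
  classical
  let Φ : Realization K → I → Realization K := fun x u => ⟨_, hpt u x⟩
  have hΦs : ∀ s ∈ K.faces, Continuous fun p : ClosedSimplex K s × I => Φ p.1.1 p.2 := by
    intro s _
    refine continuous_of_support_subset (s.biUnion W) (fun p => ?_) fun w => ?_
    · exact support_linearCombination_subset fun v hv =>
        (hW _ v).trans (Finset.subset_biUnion_of_mem W (p.1.2 hv))
    · have : (fun p : ClosedSimplex K s × I => (Φ p.1.1 p.2).1 w) =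
          fun p => ∑ v ∈ s, p.1.1.1 v * ψ p.2 v w := by
        funext p
        change Finsupp.linearCombination ℝ (ψ p.2) p.1.1.1 w = _
        rw [Finsupp.linearCombination_apply,
          Finsupp.sum_of_support_subset _ p.1.2 _ (by simp), Finsupp.finsetSum_apply]
        rfl
      rw [this]
      exact continuous_finsetSum _ fun v _ =>
        ((continuous_closedSimplex_apply s v).comp continuous_fst).mul
          ((hcont v w).comp (continuous_subtype_val.comp continuous_snd))
  have hΦ : Continuous fun p : Realization K × I => Φ p.1 p.2 := continuous_realization_prod hΦs
  have hΦ0 : ∀ x, Φ x 0 = x := by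
    intro x
    apply Subtype.ext
    change Finsupp.linearCombination ℝ (ψ 0) x.1 = x.1
    have : ψ 0 = fun v => Finsupp.single v 1 := funext h0
    simp [this, Finsupp.linearCombination_apply]
  have hΦ1 : ∀ x, Φ x 1 = β := fun x => Subtype.ext (h1 x)
  rw [contractible_iff_id_nullhomotopic]
  have hΦF : ∀ p : I × F, Φ p.2 p.1 ∈ F := fun p => hF _ p.2.2 _ _ rfl
  have hcF : Continuous fun p : I × F => (⟨Φ p.2 p.1, hΦF p⟩ : F) :=
    (hΦ.comp ((continuous_subtype_val.comp continuous_snd).prodMk continuous_fst)).subtype_mk _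
  exact ⟨⟨β, hβ⟩, ⟨⟨⟨_, hcF⟩, fun x => Subtype.ext (hΦ0 x), fun x => Subtype.ext (hΦ1 x)⟩⟩⟩

/-- If the vertices of `K` are moved linearly by `Q 0, Q 1, …`, where each vertex is fixed by almost
all `Q r`, where `Q 0` is constant, and where the segments from `Q r x` to `Q (r + 1) x` are
contained in `K`, then `K` contracts along these segments. -/
theorem contractibleSpace_of_linear_retractions (Q : ℕ → V → V →₀ ℝ) (β : Realization K)
    (hQ : ∀ (x : Realization K) (r : ℕ), ∀ a ∈ Set.Icc (0 : ℝ) 1,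
      IsPoint K ((1 - a) • Finsupp.linearCombination ℝ (Q r) x.1 +
        a • Finsupp.linearCombination ℝ (Q (r + 1)) x.1))
    (hstab : ∀ v, ∃ N, ∀ r, N ≤ r → Q r v = Finsupp.single v 1)
    (h0 : ∀ x : Realization K, Finsupp.linearCombination ℝ (Q 0) x.1 = β.1)
    (F : Set (Realization K)) (hβ : β ∈ F)
    (hF : ∀ x ∈ F, ∀ (y : Realization K) (r : ℕ) (a : ℝ),
      y.1 = (1 - a) • Finsupp.linearCombination ℝ (Q r) x.1 +
        a • Finsupp.linearCombination ℝ (Q (r + 1)) x.1 → y ∈ F) :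
    ContractibleSpace F := by
  classical
  choose N hN using hstab
  -- At `u = 0` all weights are `1` and the sum telescopes to `Q (N v) v`, which is `v` itself; at
  -- `u = 1` all weights are `0` and `Q 0 v` remains.
  let ψ : ℝ → V → V →₀ ℝ := fun u v =>
    Q 0 v + ∑ r ∈ Finset.range (N v), ramp r u • (Q (r + 1) v - Q r v)
  have hψ : ∀ (u : ℝ) (x : V →₀ ℝ) (M : ℕ), (∀ v ∈ x.support, N v ≤ M) →
      Finsupp.linearCombination ℝ (ψ u) x = Finsupp.linearCombination ℝ (Q 0) x +
        ∑ r ∈ Finset.range M, ramp r u • (Finsupp.linearCombination ℝ (Q (r + 1)) x -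
          -- A bound `M` common to the support replaces the individual `N v`, because the additional
          -- differences are zero.
          Finsupp.linearCombination ℝ (Q r) x) := by
    intro u x M hM
    have h1 : ∀ v ∈ x.support, ψ u v =
        Q 0 v + ∑ r ∈ Finset.range M, ramp r u • (Q (r + 1) v - Q r v) := by
      intro v hv
      refine congrArg (Q 0 v + ·) (Finset.sum_subset
        (Finset.range_mono (hM v hv)) fun r _ hr => ?_)
      rw [Finset.mem_range, not_lt] at hr
      rw [hN v r hr, hN v (r + 1) (by omega), sub_self, smul_zero]
    simp only [Finsupp.linearCombination_apply, Finsupp.sum]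
    rw [Finset.sum_congr rfl fun v hv => by rw [h1 v hv]]
    simp only [smul_add, Finset.sum_add_distrib, Finset.smul_sum, ← Finset.sum_sub_distrib]
    rw [Finset.sum_comm]
    congr 1
    refine Finset.sum_congr rfl fun r _ => Finset.sum_congr rfl fun v _ => ?_
    rw [← smul_sub, smul_comm]
  have hseg : ∀ (u : ℝ) (x : Realization K), ∃ m, ∃ a ∈ Set.Icc (0 : ℝ) 1,
      Finsupp.linearCombination ℝ (ψ u) x.1 = (1 - a) • Finsupp.linearCombination ℝ (Q m) x.1 +
        a • Finsupp.linearCombination ℝ (Q (m + 1)) x.1 := by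
    intro u x
    rw [hψ u x.1 (x.1.support.sup N) fun v hv => Finset.le_sup hv]
    exact exists_sum_ramp_eq (fun r => Finsupp.linearCombination ℝ (Q r) x.1) u _
  refine contractibleSpace_of_linear_homotopy ψ β (fun u x => ?_)
    (fun v => (Finset.range (N v + 1)).biUnion fun r => (Q r v).support) (fun u v => ?_)
    (fun v w => ?_) (fun v => ?_) (fun x => ?_) F hβ fun x hx y u hy => ?_
  · obtain ⟨m, a, ha, h⟩ := hseg u x
    rw [h]
    exact hQ x m a ha
  · have hmem : ∀ r ≤ N v, (Q r v).support ⊆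
        (Finset.range (N v + 1)).biUnion fun r => (Q r v).support := fun r hr =>
      Finset.subset_biUnion_of_mem (fun r => (Q r v).support) (Finset.mem_range_succ_iff.2 hr)
    refine Finsupp.support_add.trans (Finset.union_subset (hmem 0 (Nat.zero_le _)) ?_)
    refine Finsupp.support_finsetSum.trans (Finset.biUnion_subset.2 fun r hr => ?_)
    rw [Finset.mem_range] at hr
    exact Finsupp.support_smul.trans (Finsupp.support_sub.trans
      (Finset.union_subset (hmem _ (by omega)) (hmem _ (by omega))))
  · simp only [ψ, Finsupp.add_apply, Finsupp.finsetSum_apply, Finsupp.smul_apply]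
    exact continuous_const.add (continuous_finsetSum _ fun r _ =>
      (continuous_ramp r).smul continuous_const)
  · simp only [ψ, ramp_zero, one_smul]
    rw [Finset.sum_range_sub (fun r => Q r v), add_sub_cancel, hN v _ le_rfl]
  · rw [hψ _ _ (x.1.support.sup N) fun v hv => Finset.le_sup hv]
    simp [ramp_one, h0]
  · obtain ⟨m, a, _, h⟩ := hseg u x
    exact hF x hx y m a (hy.trans h)

end Contraction

/-! ### Retractions of flag complexes onto dominating sets of vertices -/

section Retraction

variable {V : Type*} {Γ : SimpleGraph V} {T : ℕ → Finset V}

open Classical in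
/-- The vertices of `T r` that dominate `v` in `T (r + 1)`. -/
noncomputable def dominators (Γ : SimpleGraph V) (T : ℕ → Finset V) (r : ℕ) (v : V) : Finset V :=
  {π ∈ T r | ∀ σ ∈ T (r + 1), (σ = v ∨ Γ.Adj v σ) → (σ = π ∨ Γ.Adj π σ)}

theorem mem_dominators {r : ℕ} {v π : V} : π ∈ dominators Γ T r v ↔
    π ∈ T r ∧ ∀ σ ∈ T (r + 1), (σ = v ∨ Γ.Adj v σ) → (σ = π ∨ Γ.Adj π σ) := by
  simp [dominators]

open Classical in
/-- The images of the vertices under the linear retraction from the subcomplex spanned by `T r`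
onto that spanned by `T (r - 1)` for `r > 0`, and onto the barycentre of `T 0` for `r = 0`. -/
noncomputable def retractStep (Γ : SimpleGraph V) (T : ℕ → Finset V) : ℕ → V → V →₀ ℝ
  | 0, _ => barycentre (T 0)
  | r + 1, v => if v ∈ T r then Finsupp.single v 1 else barycentre (dominators Γ T r v)

/-- The least index from which on `retractStep` fixes the vertex `v`. -/
noncomputable def level (hT : ∀ v, ∃ r, v ∈ T r) (v : V) : ℕ :=
  open Classical in Nat.find (hT v) + 1

/-- The image of `v` under the last `k` of the retractions that move it. -/
noncomputable def retractIter (Γ : SimpleGraph V) (hT : ∀ v, ∃ r, v ∈ T r) (v : V) : ℕ → V →₀ ℝ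
  | 0 => Finsupp.single v 1
  | k + 1 => Finsupp.linearCombination ℝ (retractStep Γ T (level hT v - (k + 1)))
      (retractIter Γ hT v k)

/-- The image of `v` under the composition of `retractStep` for all indices at least `r`. -/
noncomputable def retract (Γ : SimpleGraph V) (hT : ∀ v, ∃ r, v ∈ T r) (r : ℕ) (v : V) : V →₀ ℝ :=
  retractIter Γ hT v (level hT v - r)

variable {hT : ∀ v, ∃ r, v ∈ T r}

theorem retract_of_level_le {r : ℕ} {v : V} (h : level hT v ≤ r) :
    retract Γ hT r v = Finsupp.single v 1 := by
  rw [retract, Nat.sub_eq_zero_of_le h, retractIter]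

theorem mem_of_level_le (hmono : Monotone T) {r : ℕ} {v : V} (h : level hT v ≤ r + 1) :
    v ∈ T r := by
  classical
  exact hmono (Nat.le_of_succ_le_succ h) (Nat.find_spec (hT v))

/-- Below the level of `v` this is the recursion defining `retractIter`; from the level on, both
sides are `v`, which the step fixes. Since levels are positive, the constant step `0` occurs only in
the first case. -/
theorem retract_eq (hmono : Monotone T) (r : ℕ) (v : V) : retract Γ hT r v =
    Finsupp.linearCombination ℝ (retractStep Γ T r) (retract Γ hT (r + 1) v) := by
  rcases lt_or_ge r (level hT v) with h | h
  · obtain ⟨k, hk⟩ : ∃ k, level hT v - r = k + 1 := ⟨level hT v - r - 1, by omega⟩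
    have hk' : level hT v - (r + 1) = k := by omega
    have hr : level hT v - (k + 1) = r := by omega
    rw [retract, hk, retractIter, hr, retract, hk']
  · obtain ⟨r, rfl⟩ : ∃ r', r = r' + 1 := ⟨r - 1, by rw [level] at h; omega⟩
    rw [retract_of_level_le h, retract_of_level_le (by omega)]
    simp [retractStep, mem_of_level_le hmono h]

theorem linearCombination_retract (hmono : Monotone T) (r : ℕ) (x : V →₀ ℝ) :
    Finsupp.linearCombination ℝ (retract Γ hT r) x = Finsupp.linearCombination ℝ
      (retractStep Γ T r) (Finsupp.linearCombination ℝ (retract Γ hT (r + 1)) x) := by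
  have : Finsupp.linearCombination ℝ (retract Γ hT r) = Finsupp.linearCombination ℝ
      (retractStep Γ T r) ∘ₗ (Finsupp.linearCombination ℝ (retract Γ hT (r + 1))) := by
    refine Finsupp.lhom_ext' fun v => LinearMap.ext_ring ?_
    simp [← retract_eq hmono]
  rw [this]
  rfl

theorem linearCombination_retract_of_level_le {r : ℕ} {x : V →₀ ℝ}
    (h : ∀ v ∈ x.support, level hT v ≤ r) :
    Finsupp.linearCombination ℝ (retract Γ hT r) x = x := by
  rw [Finsupp.linearCombination_apply, Finsupp.sum]
  conv_rhs => rw [← Finsupp.sum_single x]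
  refine Finset.sum_congr rfl fun v hv => ?_
  rw [retract_of_level_le (h v hv)]
  simp

theorem isPoint_lineMap_retractStep_zero (h0 : (T 0).Nonempty) (hclique : Γ.IsClique (T 0 : Set V))
    {y : V →₀ ℝ} (hy : IsPoint (flagComplex Γ) y) (hyT : y.support ⊆ T 0) {a : ℝ}
    (ha : a ∈ Set.Icc (0 : ℝ) 1) : IsPoint (flagComplex Γ)
      ((1 - a) • Finsupp.linearCombination ℝ (retractStep Γ T 0) y + a • y) :=
  isPoint_lineMap_linearCombination (K := flagComplex Γ) (s := T 0) ⟨h0, hclique⟩ hy hyT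
    (fun _ _ => support_barycentre_subset _) (fun _ _ => barycentre_nonneg _)
    (fun _ _ => coordSum_barycentre h0) ha

/-- Flagness enters here. If `p` dominates `v` and `q` dominates `w`, with `v` and `w` in the
simplex of `y`, then `w` is equal or adjacent to `p`, and therefore `p` to `q`. So the simplex of
`y` and all image vertices span one common simplex, which contains the segment. -/
theorem isPoint_lineMap_retractStep_succ (hmono : Monotone T) {r : ℕ}
    (hdom : ∀ v ∈ T (r + 1), v ∉ T r → (dominators Γ T r v).Nonempty)
    {y : V →₀ ℝ} (hy : IsPoint (flagComplex Γ) y) (hyT : y.support ⊆ T (r + 1)) {a : ℝ}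
    (ha : a ∈ Set.Icc (0 : ℝ) 1) : IsPoint (flagComplex Γ)
      ((1 - a) • Finsupp.linearCombination ℝ (retractStep Γ T (r + 1)) y + a • y) := by
  classical
  have hstep : ∀ v p, p ∈ (retractStep Γ T (r + 1) v).support →
      p = v ∨ p ∈ dominators Γ T r v := by
    intro v p hp
    rw [retractStep] at hp
    split_ifs at hp with h
    · exact Or.inl (Finset.mem_singleton.1 (Finsupp.support_single_subset hp))
    · exact Or.inr (support_barycentre_subset _ hp)
  let s : Finset V := y.support ∪ y.support.biUnion fun v => (retractStep Γ T (r + 1) v).support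
  have hs : ∀ p ∈ s, p ∈ T (r + 1) ∧ ∃ v ∈ y.support,
      ∀ σ ∈ T (r + 1), (σ = v ∨ Γ.Adj v σ) → (σ = p ∨ Γ.Adj p σ) := by
    intro p hp
    rcases Finset.mem_union.1 hp with hp | hp
    · exact ⟨hyT hp, p, hp, fun _ _ h => h⟩
    · obtain ⟨v, hv, hpv⟩ := Finset.mem_biUnion.1 hp
      rcases hstep v p hpv with rfl | h
      · exact ⟨hyT hv, p, hv, fun _ _ h => h⟩
      · exact ⟨hmono (Nat.le_succ r) (mem_dominators.1 h).1, v, hv, (mem_dominators.1 h).2⟩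
  have hface : s ∈ (flagComplex Γ).faces := by
    refine ⟨hy.1.1.mono Finset.subset_union_left, fun p hp q hq hpq => ?_⟩
    obtain ⟨hpT, v, hv, hpv⟩ := hs p hp
    obtain ⟨hqT, w, hw, hqw⟩ := hs q hq
    have h1 : w = v ∨ Γ.Adj v w := by
      by_cases hvw : v = w
      · exact Or.inl hvw.symm
      · exact Or.inr (hy.1.2 hv hw hvw)
    have h2 : p = w ∨ Γ.Adj w p := (hpv w (hyT hw) h1).imp Eq.symm SimpleGraph.Adj.symm
    exact ((hqw p hpT h2).resolve_left hpq).symm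
  refine isPoint_lineMap_linearCombination hface hy Finset.subset_union_left
    (fun v hv => (Finset.subset_biUnion_of_mem (fun v => (retractStep Γ T (r + 1) v).support)
      hv).trans Finset.subset_union_right) (fun v _ w => ?_) (fun v hv => ?_) ha
  · rw [retractStep]
    split_ifs with h
    · exact Finsupp.single_nonneg.2 zero_le_one w
    · exact barycentre_nonneg _ _
  · rw [retractStep]
    split_ifs with h
    · exact coordSum_single _ _
    · exact coordSum_barycentre (hdom v (hyT hv) h)

theorem support_linearCombination_retractStep_succ_subset {r : ℕ} (y : V →₀ ℝ) :
    (Finsupp.linearCombination ℝ (retractStep Γ T (r + 1)) y).support ⊆ T r := by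
  classical
  refine support_linearCombination_subset fun v _ => ?_
  rw [retractStep]
  split_ifs with h
  · exact Finsupp.support_single_subset.trans (Finset.singleton_subset_iff.2 h)
  · exact (support_barycentre_subset _).trans fun π hπ => (mem_dominators.1 hπ).1

theorem isPoint_retract_succ (hmono : Monotone T)
    (hdom : ∀ r, ∀ v ∈ T (r + 1), v ∉ T r → (dominators Γ T r v).Nonempty)
    {x : V →₀ ℝ} (hx : IsPoint (flagComplex Γ) x) (r : ℕ) :
    IsPoint (flagComplex Γ) (Finsupp.linearCombination ℝ (retract Γ hT (r + 1)) x) ∧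
      (Finsupp.linearCombination ℝ (retract Γ hT (r + 1)) x).support ⊆ T r := by
  have hlarge : ∀ r, x.support.sup (level hT) ≤ r →
      IsPoint (flagComplex Γ) (Finsupp.linearCombination ℝ (retract Γ hT (r + 1)) x) ∧
        (Finsupp.linearCombination ℝ (retract Γ hT (r + 1)) x).support ⊆ T r := by
    intro r hr
    have hlev : ∀ v ∈ x.support, level hT v ≤ r + 1 := fun v hv =>
      (Finset.le_sup hv).trans (hr.trans (Nat.le_succ r))
    rw [linearCombination_retract_of_level_le hlev]
    exact ⟨hx, fun v hv => mem_of_level_le hmono (hlev v hv)⟩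
  rcases le_total (x.support.sup (level hT)) r with h | h
  · exact hlarge r h
  -- The recursion for `retract` goes from larger to smaller indices and starts where the whole
  -- support of `x` is still fixed.
  · induction h using Nat.decreasingInduction with
    | self => exact hlarge _ le_rfl
    | of_succ k _ ih =>
      rw [linearCombination_retract hmono]
      refine ⟨?_, support_linearCombination_retractStep_succ_subset _⟩
      -- The image itself is the endpoint `a = 0` of the segment.
      simpa using isPoint_lineMap_retractStep_succ hmono (hdom k) ih.1 ih.2 (a := 0) (by simp)

theorem isPoint_lineMap_retract (hmono : Monotone T) (h0 : (T 0).Nonempty)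
    (hclique : Γ.IsClique (T 0 : Set V))
    (hdom : ∀ r, ∀ v ∈ T (r + 1), v ∉ T r → (dominators Γ T r v).Nonempty)
    {x : V →₀ ℝ} (hx : IsPoint (flagComplex Γ) x) (r : ℕ) {a : ℝ} (ha : a ∈ Set.Icc (0 : ℝ) 1) :
    IsPoint (flagComplex Γ) ((1 - a) • Finsupp.linearCombination ℝ (retract Γ hT r) x +
      a • Finsupp.linearCombination ℝ (retract Γ hT (r + 1)) x) := by
  rw [linearCombination_retract hmono r]
  obtain ⟨h1, h2⟩ := isPoint_retract_succ (hT := hT) hmono hdom hx r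
  cases r with
  | zero => exact isPoint_lineMap_retractStep_zero h0 hclique h1 h2 ha
  | succ r => exact isPoint_lineMap_retractStep_succ hmono (hdom r) h1 h2 ha

theorem linearCombination_retract_zero (hmono : Monotone T)
    (hdom : ∀ r, ∀ v ∈ T (r + 1), v ∉ T r → (dominators Γ T r v).Nonempty)
    {x : V →₀ ℝ} (hx : IsPoint (flagComplex Γ) x) :
    Finsupp.linearCombination ℝ (retract Γ hT 0) x = barycentre (T 0) := by
  rw [linearCombination_retract hmono]
  have h1 := (isPoint_retract_succ (hT := hT) hmono hdom hx 0).1.2.2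
  generalize Finsupp.linearCombination ℝ (retract Γ hT (0 + 1)) x = y at h1
  rw [Finsupp.linearCombination_apply]
  simp only [retractStep]
  rw [Finsupp.sum, ← Finset.sum_smul]
  exact (congrArg (· • barycentre (T 0)) h1).trans (one_smul _ _)

/-- All dominators are used with equal weight, so the step depends only on `Γ` and `T`, both
preserved by `e`. -/
theorem retractStep_equiv (e : V ≃ V) (he : ∀ v w, Γ.Adj (e v) (e w) ↔ Γ.Adj v w)
    (heT : ∀ r v, e v ∈ T r ↔ v ∈ T r) (r : ℕ) (v : V) :
    retractStep Γ T r (e v) = Finsupp.lmapDomain ℝ ℝ e (retractStep Γ T r v) := by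
  classical
  cases r with
  | zero =>
    rw [retractStep, retractStep, lmapDomain_barycentre]
    congr 1
    ext w
    obtain ⟨w, rfl⟩ := e.surjective w
    simp [heT]
  | succ r =>
    simp only [retractStep, heT]
    split_ifs with h
    · simp [Finsupp.mapDomain_single]
    · rw [lmapDomain_barycentre]
      congr 1
      ext w
      obtain ⟨w, rfl⟩ := e.surjective w
      simp only [mem_dominators, heT, Finset.mem_map_equiv, Equiv.symm_apply_apply]
      refine and_congr_right fun _ => ?_
      rw [← e.forall_congr_right]
      simp only [heT, e.apply_eq_iff_eq, he]

theorem linearCombination_equivariant {k : V → V →₀ ℝ} (e : V ≃ V)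
    (hk : ∀ v, k (e v) = Finsupp.lmapDomain ℝ ℝ e (k v)) (x : V →₀ ℝ) :
    Finsupp.linearCombination ℝ k (Finsupp.lmapDomain ℝ ℝ e x) =
      Finsupp.lmapDomain ℝ ℝ e (Finsupp.linearCombination ℝ k x) := by
  have : Finsupp.linearCombination ℝ k ∘ₗ Finsupp.lmapDomain ℝ ℝ e =
      Finsupp.lmapDomain ℝ ℝ e ∘ₗ Finsupp.linearCombination ℝ k := by
    refine Finsupp.lhom_ext' fun v => LinearMap.ext_ring ?_
    simp [hk, Finsupp.mapDomain_single]
  exact LinearMap.congr_fun this x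

theorem retract_equiv (hmono : Monotone T) (e : V ≃ V) (he : ∀ v w, Γ.Adj (e v) (e w) ↔ Γ.Adj v w)
    (heT : ∀ r v, e v ∈ T r ↔ v ∈ T r) (r : ℕ) (v : V) :
    retract Γ hT r (e v) = Finsupp.lmapDomain ℝ ℝ e (retract Γ hT r v) := by
  have hlarge : ∀ r, max (level hT v) (level hT (e v)) ≤ r →
      retract Γ hT r (e v) = Finsupp.lmapDomain ℝ ℝ e (retract Γ hT r v) := by
    intro r hr
    rw [retract_of_level_le ((le_max_right _ _).trans hr),
      retract_of_level_le ((le_max_left _ _).trans hr)]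
    simp [Finsupp.mapDomain_single]
  rcases le_total (max (level hT v) (level hT (e v))) r with h | h
  · exact hlarge r h
  · induction h using Nat.decreasingInduction with
    | self => exact hlarge _ le_rfl
    | of_succ k _ ih =>
      rw [retract_eq hmono, ih, linearCombination_equivariant e (retractStep_equiv e he heT k),
        ← retract_eq hmono]

/-- A flag complex with an exhaustion by finite sets of vertices, each of which is obtained from the
previous one by adding dominated vertices, is contractible, equivariantly with respect to the
automorphisms that preserve the exhaustion. -/
theorem contractibleSpace_of_dominators (hmono : Monotone T) (hT : ∀ v, ∃ r, v ∈ T r)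
    (h0 : (T 0).Nonempty) (hclique : Γ.IsClique (T 0 : Set V))
    (hdom : ∀ r, ∀ v ∈ T (r + 1), v ∉ T r → (dominators Γ T r v).Nonempty)
    (E : Set (V ≃ V)) (hE : ∀ e ∈ E, ∀ v w, Γ.Adj (e v) (e w) ↔ Γ.Adj v w)
    (hET : ∀ e ∈ E, ∀ r v, e v ∈ T r ↔ v ∈ T r) :
    ContractibleSpace {x : Realization (flagComplex Γ) |
      ∀ e ∈ E, Finsupp.lmapDomain ℝ ℝ e x.1 = x.1} := by
  refine contractibleSpace_of_linear_retractions (retract Γ hT)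
    ⟨barycentre (T 0), isPoint_barycentre (K := flagComplex Γ) ⟨h0, hclique⟩⟩
    (fun x r a ha => isPoint_lineMap_retract hmono h0 hclique hdom x.2 r ha)
    (fun v => ⟨level hT v, fun r hr => retract_of_level_le hr⟩)
    (fun x => linearCombination_retract_zero hmono hdom x.2) _ (fun e he => ?_)
    fun x hx y r a hy e he => ?_
  · change Finsupp.lmapDomain ℝ ℝ e (barycentre (T 0)) = barycentre (T 0)
    rw [lmapDomain_barycentre]
    congr 1
    ext w
    obtain ⟨w, rfl⟩ := e.surjective w
    simp [hET e he]
  · rw [hy, map_add, map_smul, map_smul,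
      ← linearCombination_equivariant e (retract_equiv hmono e (hE e he) (hET e he) r),
      ← linearCombination_equivariant e (retract_equiv hmono e (hE e he) (hET e he) (r + 1)),
      hx e he]

end Retraction

/-! ### Cells of the barycentric subdivision -/

section Chains

variable {V : Type*} {K : AbstractSimplicialComplex V}

open Classical in
-- Take a vertex of `s` that lies in the fewest members of `c`. If it lay in a member `t` not
-- containing `s`, then a vertex of `s` outside `t` would lie in strictly fewer.
theorem exists_minimal_mem_of_isChain {c : Finset (Finset V)}
    (hc : IsChain (· ⊆ ·) (c : Set (Finset V))) {s : Finset V} (hne : s.Nonempty) :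
    ∃ v ∈ s, ∀ t ∈ c, v ∈ t → s ⊆ t := by
  obtain ⟨v, hv, hmin⟩ := s.exists_min_image (fun v => {t ∈ c | v ∈ t}.card) hne
  refine ⟨v, hv, fun t ht hvt => ?_⟩
  by_contra hst
  obtain ⟨v', hv's, hv't⟩ := Finset.not_subset.1 hst
  refine (hmin v' hv's).not_gt (Finset.card_lt_card (Finset.ssubset_iff_of_subset ?_ |>.2
    ⟨t, by simp [ht, hvt], by simp [hv't]⟩))
  intro t' ht'
  simp only [Finset.mem_filter] at ht' ⊢
  refine ⟨ht'.1, ?_⟩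
  rcases hc.total ht ht'.1 with h | h
  · exact h hvt
  · exact absurd (h ht'.2) hv't

open Classical in
theorem sum_chain_lt {c : Finset (Finset V)} (hc : IsChain (· ⊆ ·) (c : Set (Finset V)))
    {u : Finset V → ℝ} (hu : ∀ s ∈ c, 0 < u s) {s : Finset V} (hs : s ∈ c) {v v' : V}
    (hv : v ∈ s) (hv' : v' ∉ s) :
    (∑ t ∈ c, if v' ∈ t then u t else 0) < ∑ t ∈ c, if v ∈ t then u t else 0 := by
  refine Finset.sum_lt_sum (fun t ht => ?_) ⟨s, hs, by simp [hv, hv', hu s hs]⟩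
  by_cases h' : v' ∈ t
  · have : v ∈ t := by
      rcases hc.total hs ht with h | h
      · exact h hv
      · exact absurd (h h') hv'
    simp [h', this]
  · rw [if_neg h']
    split_ifs
    · exact (hu t ht).le
    · exact le_rfl

open Classical in
theorem sum_chain_le {c : Finset (Finset V)} {u : Finset V → ℝ} (hu : ∀ s ∈ c, 0 < u s) {v v' : V}
    (h : ∀ t ∈ c, v ∈ t → v' ∈ t) :
    (∑ t ∈ c, if v ∈ t then u t else 0) ≤ ∑ t ∈ c, if v' ∈ t then u t else 0 := by
  refine Finset.sum_le_sum fun t ht => ?_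
  by_cases hv : v ∈ t
  · simp [hv, h t ht hv]
  · rw [if_neg hv]
    split_ifs
    · exact (hu t ht).le
    · exact le_rfl

open Classical in
/-- The members of a chain are the superlevel sets of positive combinations of the indicators. -/
theorem mem_chain_iff {c : Finset (Finset V)} (hc : IsChain (· ⊆ ·) (c : Set (Finset V)))
    (hne : ∀ s ∈ c, s.Nonempty) {u : Finset V → ℝ} (hu : ∀ s ∈ c, 0 < u s) {x : V → ℝ}
    (hx : ∀ v, x v = ∑ t ∈ c, if v ∈ t then u t else 0) (s : Finset V) :
    s ∈ c ↔ ∃ v, 0 < x v ∧ ∀ v', v' ∈ s ↔ x v ≤ x v' := by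
  -- A member that is least among those containing `v` is the superlevel set of `x` at height `x v`.
  have key : ∀ t ∈ c, ∀ v ∈ t, (∀ t' ∈ c, v ∈ t' → t ⊆ t') → ∀ v', v' ∈ t ↔ x v ≤ x v' := by
    intro t ht v hv hmin v'
    rw [hx, hx]
    refine ⟨fun hv' => sum_chain_le hu fun t' ht' hvt' => hmin t' ht' hvt' hv', fun h => ?_⟩
    by_contra hv'
    exact h.not_gt (sum_chain_lt hc hu ht hv hv')
  constructor
  · intro hs
    obtain ⟨v, hv, hmin⟩ := exists_minimal_mem_of_isChain hc (hne s hs)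
    refine ⟨v, ?_, key s hs v hv hmin⟩
    rw [hx]
    refine Finset.sum_pos' (fun t ht => ?_) ⟨s, hs, by simp [hv, hu s hs]⟩
    split_ifs
    · exact (hu t ht).le
    · exact le_rfl
  · rintro ⟨v, hv, hs⟩
    have hex : ∃ t ∈ c, v ∈ t := by
      by_contra! h
      rw [hx, Finset.sum_eq_zero fun t ht => if_neg (h t ht)] at hv
      exact lt_irrefl _ hv
    obtain ⟨t, ht, hmin⟩ := Finset.exists_min_image {t ∈ c | v ∈ t} Finset.card
      (hex.imp fun t ht => by simpa using ht)
    simp only [Finset.mem_filter, and_imp] at ht hmin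
    have : s = t := by
      ext v'
      rw [hs, key t ht.1 v ht.2 fun t' ht' hv' => ?_]
      rcases hc.total ht.1 ht' with h | h
      · exact h
      · exact (Finset.eq_of_subset_of_card_le h (hmin t' ht' hv')).ge
    exact this ▸ ht.1

open Classical in
-- Let `s` be a largest member on which `u` and `u'` differ. Some `v ∈ s` lies only in members
-- containing `s`; at this `v` all other terms agree, which forces `u s = u' s`.
theorem chain_sum_injective {c : Finset (Finset V)} (hc : IsChain (· ⊆ ·) (c : Set (Finset V)))
    (hne : ∀ s ∈ c, s.Nonempty) {u u' : Finset V → ℝ}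
    (h : ∀ v, (∑ t ∈ c, if v ∈ t then u t else 0) = ∑ t ∈ c, if v ∈ t then u' t else 0) :
    ∀ s ∈ c, u s = u' s := by
  by_contra! hex
  obtain ⟨s, hs, hmax⟩ := Finset.exists_max_image {s ∈ c | u s ≠ u' s} Finset.card
    (hex.imp fun s hs => by simpa using hs)
  simp only [Finset.mem_filter, and_imp] at hs hmax
  obtain ⟨v, hv, hmin⟩ := exists_minimal_mem_of_isChain hc (hne s hs.1)
  refine hs.2 ?_
  have h1 := h v
  rw [← Finset.add_sum_erase _ _ hs.1, ← Finset.add_sum_erase c _ hs.1, if_pos hv, if_pos hv] at h1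
  refine add_right_cancel (h1.trans (congrArg _ (Finset.sum_congr rfl fun t ht => ?_)))
  split_ifs with hvt
  · by_contra hut
    have hsub := hmin t (Finset.mem_of_mem_erase ht) hvt
    exact Finset.ne_of_mem_erase ht (Finset.eq_of_subset_of_card_le hsub
      (hmax t (Finset.mem_of_mem_erase ht) (Ne.symm hut))).symm
  · rfl

open Classical in
-- Subtracting the least positive value on the whole support makes the support smaller; the old
-- support becomes the top of the chain found by induction.
theorem exists_chain_eq (x : V →₀ ℝ) (hx : ∀ v, 0 ≤ x v) :
    ∃ (c : Finset (Finset V)) (u : Finset V → ℝ), IsChain (· ⊆ ·) (c : Set (Finset V)) ∧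
      (∀ s ∈ c, 0 < u s ∧ s.Nonempty ∧ s ⊆ x.support) ∧
      ∀ v, x v = ∑ t ∈ c, if v ∈ t then u t else 0 := by
  induction hn : x.support.card using Nat.strong_induction_on generalizing x with
  | _ n ih =>
  rcases x.support.eq_empty_or_nonempty with h0 | h0
  · rw [Finsupp.support_eq_empty] at h0
    exact ⟨∅, 0, by simp, by simp, by simp [h0]⟩
  obtain ⟨w, hw, hmin⟩ := x.support.exists_min_image x h0
  have hwpos : 0 < x w := lt_of_le_of_ne (hx w) (Finsupp.mem_support_iff.1 hw).symm
  let y : V →₀ ℝ := Finsupp.onFinset x.support (fun v => if v ∈ x.support then x v - x w else 0)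
    (by intro v hv; by_contra h; simp [h] at hv)
  have hy : ∀ v, y v = if v ∈ x.support then x v - x w else 0 := fun v => rfl
  have hyx : y.support ⊆ x.support := Finsupp.support_onFinset_subset
  have hwy : w ∉ y.support := by simp [hy]
  have hlt : y.support ⊂ x.support := (Finset.ssubset_iff_of_subset hyx).2 ⟨w, hw, hwy⟩
  obtain ⟨c, u, hc, hcu, hsum⟩ := ih _ (hn ▸ Finset.card_lt_card hlt) y (fun v => by
    rw [hy]
    split_ifs with h
    · exact sub_nonneg.2 (hmin v h)
    · exact le_rfl) rfl
  have hnot : x.support ∉ c := fun h => hlt.2 (hcu _ h).2.2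
  refine ⟨insert x.support c, Function.update u x.support (x w), ?_, ?_, ?_⟩
  · rw [Finset.coe_insert]
    exact hc.insert fun t ht _ => Or.inr ((hcu t ht).2.2.trans hyx)
  · intro s hs
    rcases Finset.mem_insert.1 hs with rfl | hs
    · exact ⟨by simpa using hwpos, h0, subset_rfl⟩
    · rw [Function.update_of_ne (show s ≠ x.support from fun h => hnot (h ▸ hs))]
      exact ⟨(hcu s hs).1, (hcu s hs).2.1, (hcu s hs).2.2.trans hyx⟩
  · intro v
    rw [Finset.sum_insert hnot, Function.update_self]
    have : (∑ t ∈ c, if v ∈ t then Function.update u x.support (x w) t else 0) = y v := by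
      rw [hsum]
      refine Finset.sum_congr rfl fun t ht => ?_
      rw [Function.update_of_ne (show t ≠ x.support from fun h => hnot (h ▸ ht))]
    rw [this, hy]
    split_ifs with h
    · ring
    · simpa using h

/-- The combination with weights `w` of the barycentres of the members of `c`. -/
noncomputable def chainSum (c : Finset (Finset V)) (w : Finset V → ℝ) : V →₀ ℝ :=
  ∑ s ∈ c, w s • barycentre s

open Classical in
theorem chainSum_apply (c : Finset (Finset V)) (w : Finset V → ℝ) (v : V) :
    chainSum c w v = ∑ s ∈ c, if v ∈ s then w s / s.card else 0 := by
  rw [chainSum, Finsupp.finsetSum_apply]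
  refine Finset.sum_congr rfl fun s _ => ?_
  rw [Finsupp.smul_apply, barycentre_apply]
  split_ifs <;> simp [div_eq_mul_inv]

theorem chainSum_congr {c : Finset (Finset V)} {w w' : Finset V → ℝ} (h : ∀ s ∈ c, w s = w' s) :
    chainSum c w = chainSum c w' :=
  Finset.sum_congr rfl fun s hs => by rw [h s hs]

theorem chainSum_injective {c : Finset (Finset V)} (hc : IsChain (· ⊆ ·) (c : Set (Finset V)))
    (hne : ∀ s ∈ c, s.Nonempty) {w w' : Finset V → ℝ} (h : chainSum c w = chainSum c w') :
    ∀ s ∈ c, w s = w' s := by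
  classical
  intro s hs
  have h1 := chain_sum_injective hc hne (u := fun s => w s / s.card) (u' := fun s => w' s / s.card)
    (fun v => by rw [← chainSum_apply, ← chainSum_apply, h]) s hs
  have : (s.card : ℝ) ≠ 0 := by exact_mod_cast (hne s hs).card_pos.ne'
  field_simp at h1
  exact h1

/-- The chain is recovered from the point as its family of superlevel sets at positive heights. This
makes the open cells disjoint. -/
theorem chain_eq_of_chainSum_eq {c c' : Finset (Finset V)}
    (hc : IsChain (· ⊆ ·) (c : Set (Finset V))) (hc' : IsChain (· ⊆ ·) (c' : Set (Finset V)))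
    (hne : ∀ s ∈ c, s.Nonempty) (hne' : ∀ s ∈ c', s.Nonempty) {w w' : Finset V → ℝ}
    (hw : ∀ s ∈ c, 0 < w s) (hw' : ∀ s ∈ c', 0 < w' s) (h : chainSum c w = chainSum c' w') :
    c = c' := by
  classical
  ext s
  have hpos : ∀ {d : Finset (Finset V)} {f : Finset V → ℝ}, (∀ s ∈ d, s.Nonempty) →
      (∀ s ∈ d, 0 < f s) → ∀ s ∈ d, 0 < f s / s.card := fun hd hf s hs =>
    div_pos (hf s hs) (by exact_mod_cast (hd s hs).card_pos)
  rw [mem_chain_iff hc hne (hpos hne hw) (chainSum_apply c w), h,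
    mem_chain_iff hc' hne' (hpos hne' hw') (chainSum_apply c' w')]

theorem coordSum_chainSum {c : Finset (Finset V)} (hne : ∀ s ∈ c, s.Nonempty) (w : Finset V → ℝ) :
    coordSum V (chainSum c w) = ∑ s ∈ c, w s := by
  rw [chainSum, map_sum]
  refine Finset.sum_congr rfl fun s hs => ?_
  rw [map_smul, coordSum_barycentre (hne s hs), smul_eq_mul, mul_one]

theorem support_chainSum_subset {c : Finset (Finset V)} {w : Finset V → ℝ} {t : Finset V}
    (h : ∀ s ∈ c, s ⊆ t) : (chainSum c w).support ⊆ t := by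
  classical
  exact Finsupp.support_finsetSum.trans (Finset.biUnion_subset.2 fun s hs =>
    Finsupp.support_smul.trans ((support_barycentre_subset s).trans (h s hs)))

theorem isPoint_chainSum {c : Finset (Finset V)} (hc : IsChain (· ⊆ ·) (c : Set (Finset V)))
    (hK : ∀ s ∈ c, s ∈ K.faces) {w : Finset V → ℝ} (hw : ∀ s ∈ c, 0 ≤ w s)
    (h1 : ∑ s ∈ c, w s = 1) : IsPoint K (chainSum c w) := by
  have hcne : c.Nonempty := by
    rw [Finset.nonempty_iff_ne_empty]
    rintro rfl
    simp at h1
  obtain ⟨t, ht, hmax⟩ := Finset.exists_max_image c Finset.card hcne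
  refine isPoint_of_support_subset (hK t ht) (support_chainSum_subset fun s hs => ?_) (fun v => ?_)
    ?_
  · rcases hc.total hs ht with h | h
    · exact h
    · exact (Finset.eq_of_subset_of_card_le h (hmax s hs)).ge
  · rw [chainSum, Finsupp.finsetSum_apply]
    exact Finset.sum_nonneg fun s hs => mul_nonneg (hw s hs) (barycentre_nonneg s v)
  · rw [← coordSum_apply, coordSum_chainSum fun s hs => (K.isRelLowerSet_faces (hK s hs)).1, h1]

theorem exists_chainSum_eq {x : V →₀ ℝ} (hx : IsPoint K x) :
    ∃ (c : Finset (Finset V)) (w : Finset V → ℝ), IsChain (· ⊆ ·) (c : Set (Finset V)) ∧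
      (∀ s ∈ c, s ∈ K.faces ∧ s ⊆ x.support) ∧ (∀ s ∈ c, 0 < w s) ∧ ∑ s ∈ c, w s = 1 ∧
      x = chainSum c w := by
  classical
  obtain ⟨c, u, hc, hcu, hsum⟩ := exists_chain_eq x hx.2.1
  have hcard : ∀ s ∈ c, (0 : ℝ) < s.card := fun s hs => by
    exact_mod_cast (hcu s hs).2.1.card_pos
  have hxc : x = chainSum c fun s => u s * s.card := by
    ext v
    rw [hsum, chainSum_apply]
    refine Finset.sum_congr rfl fun s hs => ?_
    rw [mul_div_cancel_right₀ _ (hcard s hs).ne']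
  refine ⟨c, _, hc, fun s hs => ⟨(K.isRelLowerSet_faces hx.1).2 (hcu s hs).2.2 (hcu s hs).2.1,
    (hcu s hs).2.2⟩, fun s hs => mul_pos (hcu s hs).1 (hcard s hs), ?_, hxc⟩
  rw [← coordSum_chainSum fun s hs => (hcu s hs).2.1, ← hxc, coordSum_apply]
  exact hx.2.2

/-- The open cell of the barycentric subdivision belonging to the chain `c`. -/
def openChainCell (K : AbstractSimplicialComplex V) (c : Finset (Finset V)) :
    Set (Realization K) :=
  {x | ∃ w : Finset V → ℝ, (∀ s ∈ c, 0 < w s) ∧ ∑ s ∈ c, w s = 1 ∧ x.1 = chainSum c w}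

/-- The closed cell of the barycentric subdivision belonging to the chain `c`. -/
def closedChainCell (K : AbstractSimplicialComplex V) (c : Finset (Finset V)) :
    Set (Realization K) :=
  {x | ∃ w : Finset V → ℝ, (∀ s ∈ c, 0 ≤ w s) ∧ ∑ s ∈ c, w s = 1 ∧ x.1 = chainSum c w}

/-- A subset is closed if its traces on the cells of the barycentric subdivision are. -/
theorem isClosed_of_closedChainCell {A : Set (Realization K)}
    (h : ∀ c : Finset (Finset V), c.Nonempty → IsChain (· ⊆ ·) (c : Set (Finset V)) →
      (∀ s ∈ c, s ∈ K.faces) → IsClosed (A ∩ closedChainCell K c)) : IsClosed A := by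
  classical
  refine isClosed_realization_iff.2 fun s hs => ?_
  -- A closed simplex is covered by the finitely many cells of chains of subsets of `s`.
  have hcover : {x : ClosedSimplex K s | x.1 ∈ A} =
      ⋃ c ∈ {c | c ∈ s.powerset.powerset ∧ c.Nonempty ∧ IsChain (· ⊆ ·) (c : Set (Finset V)) ∧
        ∀ t ∈ c, t ∈ K.faces}, {x : ClosedSimplex K s | x.1 ∈ A ∩ closedChainCell K c} := by
    ext x
    simp only [Set.mem_iUnion, Set.mem_ofPred_eq, Set.mem_inter_iff]
    refine ⟨fun hx => ?_, fun ⟨_, _, hx, _⟩ => hx⟩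
    obtain ⟨c, w, hc, hcK, hw, h1, hxc⟩ := exists_chainSum_eq x.1.2
    refine ⟨c, ⟨?_, ?_, hc, fun t ht => (hcK t ht).1⟩, hx, w, fun t ht => (hw t ht).le, h1, hxc⟩
    · rw [Finset.mem_powerset]
      exact fun t ht => Finset.mem_powerset.2 ((hcK t ht).2.trans x.2)
    · rw [Finset.nonempty_iff_ne_empty]
      rintro rfl
      simp at h1
  rw [hcover]
  refine Set.Finite.isClosed_biUnion
    (s.powerset.powerset.finite_toSet.subset fun c hc => hc.1) fun c hc => ?_
  exact isClosed_realization_iff.1 (h c hc.2.1 hc.2.2.1 hc.2.2.2) s hs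

/-- The frontier of a cell is covered by the cells of its proper subchains. -/
theorem mem_closedChainCell_filter {c : Finset (Finset V)} {w : Finset V → ℝ}
    (hw : ∀ s ∈ c, 0 ≤ w s) (h1 : ∑ s ∈ c, w s = 1) {s : Finset V} (hs : s ∈ c) (hws : w s = 0)
    {x : Realization K} (hx : x.1 = chainSum c w) :
    ∃ c' ⊆ c, c'.Nonempty ∧ c'.card < c.card ∧ x ∈ closedChainCell K c' := by
  classical
  have hsum : ∑ t ∈ c.erase s, w t = 1 := by
    rw [← h1, ← Finset.add_sum_erase c w hs, hws, zero_add]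
  refine ⟨c.erase s, Finset.erase_subset s c, ?_, Finset.card_erase_lt_of_mem hs, w,
    fun t ht => hw t (Finset.mem_of_mem_erase ht), hsum, ?_⟩
  · rw [Finset.nonempty_iff_ne_empty]
    intro h
    rw [h, Finset.sum_empty] at hsum
    exact zero_ne_one hsum
  · rw [hx, chainSum, chainSum, ← Finset.add_sum_erase c _ hs, hws, zero_smul, zero_add]

end Chains

/-! ### The CW structure given by the barycentric subdivision -/

section Simplex

variable {n : ℕ}

/-- The standard `n`-simplex, with the zeroth barycentric coordinate omitted. -/
def cornerSimplex (n : ℕ) : Set (Fin n → ℝ) := {y | (∀ i, 0 ≤ y i) ∧ ∑ i, y i ≤ 1}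

/-- The interior of the standard `n`-simplex, with the zeroth barycentric coordinate omitted. -/
def openCornerSimplex (n : ℕ) : Set (Fin n → ℝ) := {y | (∀ i, 0 < y i) ∧ ∑ i, y i < 1}

theorem isOpen_openCornerSimplex (n : ℕ) : IsOpen (openCornerSimplex n) := by
  have : openCornerSimplex n = (⋂ i, {y | 0 < y i}) ∩ {y | ∑ i, y i < 1} := by
    ext y
    simp [openCornerSimplex]
  rw [this]
  exact (isOpen_iInter_of_finite fun i => isOpen_lt continuous_const (continuous_apply i)).inter
    (isOpen_lt (continuous_finsetSum _ fun i _ => continuous_apply i) continuous_const)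

theorem isClosed_cornerSimplex (n : ℕ) : IsClosed (cornerSimplex n) := by
  have : cornerSimplex n = (⋂ i, {y | 0 ≤ y i}) ∩ {y | ∑ i, y i ≤ 1} := by
    ext y
    simp [cornerSimplex]
  rw [this]
  exact (isClosed_iInter fun i => isClosed_le continuous_const (continuous_apply i)).inter
    (isClosed_le (continuous_finsetSum _ fun i _ => continuous_apply i) continuous_const)

theorem openCornerSimplex_nonempty (n : ℕ) : (openCornerSimplex n).Nonempty := by
  refine ⟨fun _ => 1 / (n + 1), fun _ => by positivity, ?_⟩
  have : (0 : ℝ) < n + 1 := by positivity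
  rw [Finset.sum_const, Finset.card_univ, Fintype.card_fin, nsmul_eq_mul, mul_one_div,
    div_lt_one this]
  linarith

theorem lineMap_mem_openCornerSimplex {y z : Fin n → ℝ} (hy : y ∈ openCornerSimplex n)
    (hz : z ∈ cornerSimplex n) {a b : ℝ} (ha : 0 < a) (hb : 0 ≤ b) (hab : a + b = 1) :
    a • y + b • z ∈ openCornerSimplex n := by
  refine ⟨fun i => add_pos_of_pos_of_nonneg (mul_pos ha (hy.1 i)) (mul_nonneg hb (hz.1 i)), ?_⟩
  simp only [Pi.add_apply, Pi.smul_apply, smul_eq_mul, Finset.sum_add_distrib, ← Finset.mul_sum]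
  nlinarith [hy.2, hz.2, mul_lt_mul_of_pos_left hy.2 ha, mul_le_mul_of_nonneg_left hz.2 hb]

theorem openCornerSimplex_subset (n : ℕ) : openCornerSimplex n ⊆ cornerSimplex n :=
  fun _ hy => ⟨fun i => (hy.1 i).le, hy.2.le⟩

theorem convex_openCornerSimplex (n : ℕ) : Convex ℝ (openCornerSimplex n) := by
  rw [convex_iff_forall_pos]
  exact fun y hy z hz a b ha hb hab =>
    lineMap_mem_openCornerSimplex hy (openCornerSimplex_subset n hz) ha hb.le hab

theorem closure_openCornerSimplex (n : ℕ) : closure (openCornerSimplex n) = cornerSimplex n := by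
  refine (closure_minimal (openCornerSimplex_subset n) (isClosed_cornerSimplex n)).antisymm ?_
  intro z hz
  obtain ⟨y, hy⟩ := openCornerSimplex_nonempty n
  have hcont : Continuous fun a : ℝ => a • y + (1 - a) • z := by fun_prop
  have hlim : Filter.Tendsto (fun a : ℝ => a • y + (1 - a) • z) (nhdsWithin 0 (Set.Ioi 0))
      (nhds z) := by
    have := hcont.tendsto 0
    simp only [zero_smul, sub_zero, one_smul, zero_add] at this
    exact this.mono_left nhdsWithin_le_nhds
  refine mem_closure_of_tendsto hlim ?_
  filter_upwards [Ioo_mem_nhdsGT (zero_lt_one (α := ℝ))] with a ha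
  exact lineMap_mem_openCornerSimplex hy hz ha.1 (by linarith [ha.2]) (by ring)

theorem isBounded_openCornerSimplex (n : ℕ) : Bornology.IsBounded (openCornerSimplex n) := by
  refine (Metric.isBounded_closedBall (x := (0 : Fin n → ℝ)) (r := 1)).subset fun y hy => ?_
  rw [mem_closedBall_zero_iff, pi_norm_le_iff_of_nonneg zero_le_one]
  intro i
  rw [Real.norm_of_nonneg (hy.1 i).le]
  exact (Finset.single_le_sum (f := y) (fun j _ => (hy.1 j).le) (Finset.mem_univ i)).trans hy.2.le

theorem exists_homeomorph_image_ball (n : ℕ) : ∃ h : (Fin n → ℝ) ≃ₜ (Fin n → ℝ),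
    h '' Metric.ball 0 1 = openCornerSimplex n ∧ h '' Metric.closedBall 0 1 = cornerSimplex n := by
  have hint := (isOpen_openCornerSimplex n).interior_eq
  obtain ⟨h, h1, h2, -⟩ := exists_homeomorph_image_interior_closure_frontier_eq_unitBall
    (convex_openCornerSimplex n) (hint.symm ▸ openCornerSimplex_nonempty n)
    (isBounded_openCornerSimplex n)
  rw [hint] at h1
  rw [closure_openCornerSimplex] at h2
  refine ⟨h.symm, ?_, ?_⟩
  · rw [← h1, Set.image_image]
    simp
  · rw [← h2, Set.image_image]
    simp

/-- A homeomorphism that maps the unit ball onto the standard simplex. -/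
noncomputable def ballHomeomorph (n : ℕ) : (Fin n → ℝ) ≃ₜ (Fin n → ℝ) :=
  (exists_homeomorph_image_ball n).choose

theorem image_ballHomeomorph_ball (n : ℕ) :
    ballHomeomorph n '' Metric.ball 0 1 = openCornerSimplex n :=
  (exists_homeomorph_image_ball n).choose_spec.1

theorem image_ballHomeomorph_closedBall (n : ℕ) :
    ballHomeomorph n '' Metric.closedBall 0 1 = cornerSimplex n :=
  (exists_homeomorph_image_ball n).choose_spec.2

/-- All barycentric coordinates of a point of the standard simplex. -/
def cornerWeights (y : Fin n → ℝ) : Fin (n + 1) → ℝ := Fin.cons (1 - ∑ i, y i) y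

theorem sum_cornerWeights (y : Fin n → ℝ) : ∑ i, cornerWeights y i = 1 := by
  simp [cornerWeights, Fin.sum_univ_succ]

theorem continuous_cornerWeights (i : Fin (n + 1)) :
    Continuous fun y : Fin n → ℝ => cornerWeights y i := by
  cases i using Fin.cases with
  | zero => simp only [cornerWeights, Fin.cons_zero]; fun_prop
  | succ i => simp only [cornerWeights, Fin.cons_succ]; fun_prop

theorem cornerWeights_pos_iff {y : Fin n → ℝ} :
    (∀ i, 0 < cornerWeights y i) ↔ y ∈ openCornerSimplex n := by
  rw [Fin.forall_fin_succ]
  simp [cornerWeights, openCornerSimplex, and_comm]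

theorem cornerWeights_nonneg_iff {y : Fin n → ℝ} :
    (∀ i, 0 ≤ cornerWeights y i) ↔ y ∈ cornerSimplex n := by
  rw [Fin.forall_fin_succ]
  simp [cornerWeights, cornerSimplex, and_comm]

theorem cornerWeights_tail {w : Fin (n + 1) → ℝ} (hw : ∑ i, w i = 1) :
    cornerWeights (fun i => w i.succ) = w := by
  rw [Fin.sum_univ_succ] at hw
  ext i
  cases i using Fin.cases with
  | zero => simp only [cornerWeights, Fin.cons_zero]; linarith
  | succ i => simp [cornerWeights]

theorem cornerWeights_injective : Function.Injective (cornerWeights (n := n)) :=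
  fun _ _ h => (Fin.cons_injective2 h).2

end Simplex

/-! ### Chains of faces as cells, with their characteristic maps -/

section CWStructure

open Metric Set

variable {V : Type*} {K : AbstractSimplicialComplex V} {n : ℕ}

/-- The `n`-cells of the barycentric subdivision: the chains of `n + 1` faces. -/
def ChainCell (K : AbstractSimplicialComplex V) (n : ℕ) : Type _ :=
  {c : Finset (Finset V) // c.card = n + 1 ∧ IsChain (· ⊆ ·) (c : Set (Finset V)) ∧
    ∀ s ∈ c, s ∈ K.faces}

namespace ChainCell

theorem nonempty_of_mem (c : ChainCell K n) : ∀ s ∈ c.1, s.Nonempty :=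
  fun s hs => (K.isRelLowerSet_faces (c.2.2.2 s hs)).1

/-- An enumeration of the faces in a chain. -/
noncomputable def enum (c : ChainCell K n) : c.1 ≃ Fin (n + 1) := c.1.equivFinOfCardEq c.2.1

open Classical in
/-- The weights of the faces in a chain that belong to a point of the standard simplex. -/
noncomputable def weights (c : ChainCell K n) (y : Fin n → ℝ) (s : Finset V) : ℝ :=
  if h : s ∈ c.1 then cornerWeights y (c.enum ⟨s, h⟩) else 0

theorem weights_symm_enum (c : ChainCell K n) (y : Fin n → ℝ) (i : Fin (n + 1)) :
    c.weights y (c.enum.symm i).1 = cornerWeights y i := by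
  simp [weights]

theorem forall_weights (c : ChainCell K n) (y : Fin n → ℝ) (p : ℝ → Prop) :
    (∀ s ∈ c.1, p (c.weights y s)) ↔ ∀ i, p (cornerWeights y i) := by
  refine ⟨fun h i => ?_, fun h s hs => ?_⟩
  · rw [← c.weights_symm_enum]
    exact h _ (c.enum.symm i).2
  · rw [weights, dif_pos hs]
    exact h _

theorem sum_comp_enum (c : ChainCell K n) (w : Finset V → ℝ) :
    ∑ i, w (c.enum.symm i).1 = ∑ s ∈ c.1, w s := by
  rw [c.enum.symm.sum_comp (fun s : c.1 => w s), Finset.sum_coe_sort]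

theorem sum_weights (c : ChainCell K n) (y : Fin n → ℝ) : ∑ s ∈ c.1, c.weights y s = 1 := by
  rw [← c.sum_comp_enum, ← sum_cornerWeights y]
  exact Finset.sum_congr rfl fun i _ => c.weights_symm_enum y i

theorem exists_weights_eq (c : ChainCell K n) {w : Finset V → ℝ} (hw : ∑ s ∈ c.1, w s = 1) :
    ∃ y : Fin n → ℝ, ∀ s ∈ c.1, c.weights y s = w s := by
  refine ⟨fun i => w (c.enum.symm i.succ).1, fun s hs => ?_⟩
  rw [weights, dif_pos hs, cornerWeights_tail (w := fun i => w (c.enum.symm i).1)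
    ((c.sum_comp_enum w).trans hw)]
  simp

theorem continuous_weights (c : ChainCell K n) (s : Finset V) :
    Continuous fun y => c.weights y s := by
  unfold weights
  split_ifs
  · exact continuous_cornerWeights _
  · exact continuous_const

theorem isPoint_weights (c : ChainCell K n) {y : Fin n → ℝ} (hy : y ∈ cornerSimplex n) :
    IsPoint K (chainSum c.1 (c.weights y)) :=
  isPoint_chainSum c.2.2.1 c.2.2.2
    ((c.forall_weights y _).2 (cornerWeights_nonneg_iff.2 hy)) (c.sum_weights y)

theorem nonempty_realization (c : ChainCell K n) : Nonempty (Realization K) :=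
  ⟨⟨_, c.isPoint_weights (openCornerSimplex_subset n (openCornerSimplex_nonempty n).choose_spec)⟩⟩

open Classical in
/-- The characteristic map of a cell of the barycentric subdivision. -/
noncomputable def charMap (c : ChainCell K n) (z : Fin n → ℝ) : Realization K :=
  -- The default value is never used on the closed unit ball, the only place where the map matters.
  if h : IsPoint K (chainSum c.1 (c.weights (ballHomeomorph n z))) then ⟨_, h⟩ else
    c.nonempty_realization.some

theorem ballHomeomorph_mem {z : Fin n → ℝ} (hz : z ∈ closedBall (0 : Fin n → ℝ) 1) :
    ballHomeomorph n z ∈ cornerSimplex n :=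
  image_ballHomeomorph_closedBall n ▸ mem_image_of_mem _ hz

theorem charMap_val (c : ChainCell K n) {z : Fin n → ℝ} (hz : z ∈ closedBall (0 : Fin n → ℝ) 1) :
    (c.charMap z).1 = chainSum c.1 (c.weights (ballHomeomorph n z)) := by
  have h : c.charMap z = ⟨_, c.isPoint_weights (ballHomeomorph_mem hz)⟩ := dif_pos _
  exact congrArg Subtype.val h

theorem continuousOn_charMap (c : ChainCell K n) :
    ContinuousOn c.charMap (closedBall (0 : Fin n → ℝ) 1) := by
  classical
  rw [continuousOn_iff_continuous_domRestrict]
  refine continuous_of_support_subset (c.1.biUnion id) (fun z => ?_) fun v => ?_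
  · rw [domRestrict_apply, c.charMap_val z.2]
    exact support_chainSum_subset fun s hs => Finset.subset_biUnion_of_mem id hs
  · have : (fun z : closedBall (0 : Fin n → ℝ) 1 => ((closedBall 0 1).domRestrict c.charMap z).1 v) =
        fun z => ∑ s ∈ c.1, c.weights (ballHomeomorph n z.1) s * barycentre s v := by
      funext z
      rw [domRestrict_apply, c.charMap_val z.2, chainSum, Finsupp.finsetSum_apply]
      rfl
    rw [this]
    exact continuous_finsetSum _ fun s _ => ((c.continuous_weights s).comp
      ((ballHomeomorph n).continuous.comp continuous_subtype_val)).mul continuous_const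

theorem injOn_charMap (c : ChainCell K n) : InjOn c.charMap (closedBall (0 : Fin n → ℝ) 1) := by
  intro z hz z' hz' h
  have h1 : chainSum c.1 (c.weights (ballHomeomorph n z)) =
      chainSum c.1 (c.weights (ballHomeomorph n z')) := by
    rw [← c.charMap_val hz, h, c.charMap_val hz']
  have h2 := chainSum_injective c.2.2.1 c.nonempty_of_mem h1
  refine (ballHomeomorph n).injective (cornerWeights_injective (funext fun i => ?_))
  rw [← c.weights_symm_enum, ← c.weights_symm_enum]
  exact h2 _ (c.enum.symm i).2

theorem image_charMap_ball (c : ChainCell K n) :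
    c.charMap '' ball (0 : Fin n → ℝ) 1 = openChainCell K c.1 := by
  ext x
  constructor
  · rintro ⟨z, hz, rfl⟩
    refine ⟨_, (c.forall_weights _ _).2 (cornerWeights_pos_iff.2 ?_), c.sum_weights _,
      c.charMap_val (ball_subset_closedBall hz)⟩
    exact image_ballHomeomorph_ball n ▸ mem_image_of_mem _ hz
  · rintro ⟨w, hw, h1, hx⟩
    obtain ⟨y, hy⟩ := c.exists_weights_eq h1
    have hyO : y ∈ openCornerSimplex n := cornerWeights_pos_iff.1
      ((c.forall_weights y (0 < ·)).1 fun s hs => (hy s hs).symm ▸ hw s hs)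
    rw [← image_ballHomeomorph_ball n] at hyO
    obtain ⟨z, hz, rfl⟩ := hyO
    refine ⟨z, hz, Subtype.ext ?_⟩
    rw [c.charMap_val (ball_subset_closedBall hz)]
    exact (chainSum_congr hy).trans hx.symm

theorem image_charMap_closedBall (c : ChainCell K n) :
    c.charMap '' closedBall (0 : Fin n → ℝ) 1 = closedChainCell K c.1 := by
  ext x
  constructor
  · rintro ⟨z, hz, rfl⟩
    exact ⟨_, (c.forall_weights _ _).2 (cornerWeights_nonneg_iff.2 (ballHomeomorph_mem hz)),
      c.sum_weights _, c.charMap_val hz⟩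
  · rintro ⟨w, hw, h1, hx⟩
    obtain ⟨y, hy⟩ := c.exists_weights_eq h1
    have hyO : y ∈ cornerSimplex n := cornerWeights_nonneg_iff.1
      ((c.forall_weights y (0 ≤ ·)).1 fun s hs => (hy s hs).symm ▸ hw s hs)
    rw [← image_ballHomeomorph_closedBall n] at hyO
    obtain ⟨z, hz, rfl⟩ := hyO
    refine ⟨z, hz, Subtype.ext ?_⟩
    rw [c.charMap_val hz]
    exact (chainSum_congr hy).trans hx.symm

/-- Points of the sphere go to the boundary of the standard simplex, where some weight vanishes; the
corresponding face can be dropped from the chain. -/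
theorem exists_mem_closedChainCell_of_mem_sphere (c : ChainCell K n) {z : Fin n → ℝ}
    (hz : z ∈ sphere (0 : Fin n → ℝ) 1) :
    ∃ m < n, ∃ c' : ChainCell K m, c'.1 ⊆ c.1 ∧ c.charMap z ∈ closedChainCell K c'.1 := by
  have hz' := sphere_subset_closedBall hz
  have hnot : ¬ ∀ s ∈ c.1, 0 < c.weights (ballHomeomorph n z) s := by
    rw [c.forall_weights _ (0 < ·), cornerWeights_pos_iff, ← image_ballHomeomorph_ball]
    rintro ⟨z', hz1, hz2⟩
    rw [(ballHomeomorph n).injective hz2] at hz1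
    exact (mem_ball.1 hz1).ne (mem_sphere.1 hz)
  have hw := (c.forall_weights (ballHomeomorph n z) (0 ≤ ·)).2
    (cornerWeights_nonneg_iff.2 (ballHomeomorph_mem hz'))
  push Not at hnot
  obtain ⟨s, hs, hs0⟩ := hnot
  obtain ⟨c', hc', hne, hcard, hmem⟩ := mem_closedChainCell_filter hw (c.sum_weights _) hs
    (le_antisymm hs0 (hw s hs)) (c.charMap_val hz')
  have hpos := hne.card_pos
  have := c.2.1
  exact ⟨c'.card - 1, by omega, ⟨c', by omega, c.2.2.1.mono (Finset.coe_subset.2 hc'),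
    fun t ht => c.2.2.2 t (hc' ht)⟩, hc', hmem⟩

/-- The characteristic map, as a partial equivalence on the open ball. -/
noncomputable def charEquiv (c : ChainCell K n) : PartialEquiv (Fin n → ℝ) (Realization K) :=
  (c.injOn_charMap.mono ball_subset_closedBall).bijOn_image.toPartialEquiv

theorem continuousOn_charEquiv_symm (c : ChainCell K n) :
    ContinuousOn c.charEquiv.symm c.charEquiv.target := by
  rw [continuousOn_iff_isClosed]
  intro t ht
  -- This image of a compact set is closed, as the realisation is Hausdorff. Injectivity on the
  -- whole closed ball ensures that it meets the open cell only in the image of the part of `t` in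
  -- the open ball.
  refine ⟨c.charMap '' (closedBall 0 1 ∩ t), ?_, ?_⟩
  · exact (((isCompact_closedBall _ _).inter_right ht).image_of_continuousOn
      (c.continuousOn_charMap.mono inter_subset_left)).isClosed
  · ext x
    refine and_congr_left fun hx => ?_
    obtain ⟨z, hz, rfl⟩ : x ∈ c.charMap '' ball (0 : Fin n → ℝ) 1 := hx
    have hsymm : c.charEquiv.symm (c.charMap z) = z := c.charEquiv.left_inv hz
    rw [mem_preimage, hsymm]
    refine ⟨fun h => ⟨z, ⟨ball_subset_closedBall hz, h⟩, rfl⟩, ?_⟩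
    rintro ⟨z', hz', h⟩
    rw [← c.injOn_charMap hz'.1 (ball_subset_closedBall hz) h]
    exact hz'.2

theorem finite_subset (m : ℕ) (c : Finset (Finset V)) :
    {c' : ChainCell K m | c'.1 ⊆ c}.Finite := by
  refine Set.Finite.of_finite_image (f := fun c' : ChainCell K m => c'.1)
    (c.powerset.finite_toSet.subset ?_) Subtype.val_injective.injOn
  rintro _ ⟨c', hc', rfl⟩
  exact Finset.mem_coe.2 (Finset.mem_powerset.2 hc')

theorem eq_of_mem_openChainCell {m : ℕ} {c : ChainCell K n} {c' : ChainCell K m}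
    {x : Realization K} (hx : x ∈ openChainCell K c.1) (hx' : x ∈ openChainCell K c'.1) :
    c.1 = c'.1 := by
  obtain ⟨w, hw, -, h⟩ := hx
  obtain ⟨w', hw', -, h'⟩ := hx'
  exact chain_eq_of_chainSum_eq c.2.2.1 c'.2.2.1 c.nonempty_of_mem c'.nonempty_of_mem hw hw'
    (h.symm.trans h')

theorem sigma_ext {p q : Σ n, ChainCell K n} (h : p.2.1 = q.2.1) : p = q := by
  obtain ⟨n, c, hc⟩ := p
  obtain ⟨m, c', hc'⟩ := q
  obtain rfl : c = c' := h
  obtain rfl : n = m := by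
    have := hc.1.symm.trans hc'.1
    omega
  rfl

end ChainCell

/-- The CW structure on the geometric realisation given by the barycentric subdivision. -/
noncomputable abbrev subdivisionCW (K : AbstractSimplicialComplex V) :
    Topology.CWComplex (Set.univ : Set (Realization K)) where
  cell := ChainCell K
  map _ c := c.charEquiv
  source_eq _ _ := rfl
  continuousOn _ c := c.continuousOn_charMap
  continuousOn_symm _ c := c.continuousOn_charEquiv_symm
  pairwiseDisjoint' := by
    intro p _ q _ hpq
    refine Set.disjoint_left.2 fun x hx hx' => hpq (ChainCell.sigma_ext ?_)
    exact ChainCell.eq_of_mem_openChainCell (p.2.image_charMap_ball.subset hx)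
      (q.2.image_charMap_ball.subset hx')
  mapsTo' n c := by
    refine ⟨fun m => (ChainCell.finite_subset m c.1).toFinset, fun z hz => ?_⟩
    obtain ⟨m, hm, c', hc', h⟩ := c.exists_mem_closedChainCell_of_mem_sphere hz
    simp only [Set.mem_iUnion]
    exact ⟨m, hm, c', by simpa using hc', c'.image_charMap_closedBall.superset h⟩
  closed' A _ h := by
    refine isClosed_of_closedChainCell fun c hne hc hK => ?_
    have hpos := hne.card_pos
    let c' : ChainCell K (c.card - 1) := ⟨c, by omega, hc, hK⟩
    have := h _ c'
    rwa [show (c'.charEquiv : (Fin (c.card - 1) → ℝ) → Realization K) '' closedBall 0 1 =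
      closedChainCell K c from c'.image_charMap_closedBall] at this
  union' := by
    refine Set.eq_univ_of_forall fun x => ?_
    obtain ⟨c, w, hc, hK, hw, h1, hx⟩ := exists_chainSum_eq x.2
    have hpos : 0 < c.card := by
      rw [Finset.card_pos, Finset.nonempty_iff_ne_empty]
      rintro rfl
      simp at h1
    let c' : ChainCell K (c.card - 1) := ⟨c, by omega, hc, fun s hs => (hK s hs).1⟩
    simp only [Set.mem_iUnion]
    exact ⟨c.card - 1, c', c'.image_charMap_closedBall.superset
      ⟨w, fun s hs => (hw s hs).le, h1, hx⟩⟩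

theorem openCell_subdivisionCW (n : ℕ) (c : ChainCell K n) :
    @Topology.RelCWComplex.openCell _ _ Set.univ ∅ (subdivisionCW K).instRelCWComplex n c =
      openChainCell K c.1 :=
  c.image_charMap_ball

end CWStructure

section Rips

variable {G : Type*} [Group G] {A : Set G} {D : ℕ}

/-! ### Cayley graphs -/

theorem mulCayley_connected (hgen : Subgroup.closure A = ⊤) :
    (SimpleGraph.mulCayley A).Connected := by
  have hmul : ∀ g u v : G, (SimpleGraph.mulCayley A).Reachable u v →
      (SimpleGraph.mulCayley A).Reachable (g * u) (g * v) := by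
    intro g u v h
    let f : SimpleGraph.mulCayley A →g SimpleGraph.mulCayley A :=
      ⟨fun z => g * z, fun h => SimpleGraph.mulCayley_adj_mul_iff_right.2 h⟩
    exact h.map f
  have hone : ∀ g : G, (SimpleGraph.mulCayley A).Reachable 1 g := by
    intro g
    have hg : g ∈ Subgroup.closure A := hgen ▸ Subgroup.mem_top g
    induction hg using Subgroup.closure_induction with
    | mem x hx =>
      by_cases h1 : 1 = x
      · rw [h1]
      · exact SimpleGraph.Adj.reachable (by simp [SimpleGraph.mulCayley_adj, h1, hx])
    | one => rfl
    | mul x y _ _ hx hy => exact hx.trans (by simpa using hmul x 1 y hy)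
    | inv x _ hx => exact SimpleGraph.Reachable.symm (by simpa using hmul x⁻¹ 1 x hx)
  exact (SimpleGraph.connected_iff _).2 ⟨fun u v => (hone u).symm.trans (hone v), ⟨1⟩⟩

theorem finite_dist_le (hfin : A.Finite) (hgen : Subgroup.closure A = ⊤) (u : G) (n : ℕ) :
    {x | (SimpleGraph.mulCayley A).dist u x ≤ n}.Finite := by
  have hΓ := mulCayley_connected hgen
  induction n with
  | zero =>
    refine (Set.finite_singleton u).subset fun x hx => ?_
    exact (hΓ.dist_eq_zero_iff.1 (Nat.le_zero.1 hx)).symm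
  | succ n ih =>
    have hnbr : ∀ y : G, {x | (SimpleGraph.mulCayley A).Adj y x}.Finite := by
      intro y
      refine ((hfin.union hfin.inv).image (y * ·)).subset fun x hx => ?_
      refine ⟨y⁻¹ * x, ?_, by simp⟩
      simpa using ((SimpleGraph.mulCayley_adj A y x).1 hx).2
    refine (ih.union (ih.biUnion fun y _ => hnbr y)).subset fun x hx => ?_
    change (SimpleGraph.mulCayley A).dist u x ≤ n + 1 at hx
    rcases Nat.le_succ_iff.1 hx with h | h
    · exact Or.inl h
    · obtain ⟨t, h1, h2⟩ := exists_dist_eq_of_le_dist hΓ (u := u) (v := x) (k := n) (by omega)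
      refine Or.inr (Set.mem_biUnion (x := t) h1.le ?_)
      have h3 : (SimpleGraph.mulCayley A).dist t x = 1 := by omega
      exact SimpleGraph.dist_eq_one_iff_adj.1 h3

/-! ### Balls around quasi-centres in Rips graphs -/

theorem eq_or_ripsGraph_adj_iff {u v : G} :
    (v = u ∨ (ripsGraph A D).Adj u v) ↔ (SimpleGraph.mulCayley A).dist u v ≤ D := by
  constructor
  · rintro (rfl | h)
    · simp
    · exact h.2
  · intro h
    by_cases huv : v = u
    · exact Or.inl huv
    · exact Or.inr ⟨Ne.symm huv, h⟩

theorem ripsGraph_adj_mul_left (g u v : G) :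
    (ripsGraph A D).Adj (g * u) (g * v) ↔ (ripsGraph A D).Adj u v := by
  simp [ripsGraph, dist_mul_left]

variable {O : Set G}

theorem finite_ballAround_quasiCentre (hfin : A.Finite) (hgen : Subgroup.closure A = ⊤)
    (hO : O.Nonempty) (r : ℕ) :
    (ballAround (SimpleGraph.mulCayley A) (quasiCentre (SimpleGraph.mulCayley A) O) r).Finite := by
  obtain ⟨x, hx⟩ := hO
  refine (finite_dist_le hfin hgen x (circumradius (SimpleGraph.mulCayley A) O + r)).subset ?_
  rintro y ⟨c, hc, hy⟩
  have h1 := hc x hx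
  rw [SimpleGraph.dist_comm] at h1
  exact (mulCayley_connected hgen).dist_triangle.trans (add_le_add h1 hy)

theorem mul_mem_ballAround_quasiCentre {g : G} (hg : ∀ x ∈ O, g⁻¹ * x ∈ O) {r : ℕ} {v : G}
    (hv : v ∈ ballAround (SimpleGraph.mulCayley A) (quasiCentre (SimpleGraph.mulCayley A) O) r) :
    g * v ∈ ballAround (SimpleGraph.mulCayley A) (quasiCentre (SimpleGraph.mulCayley A) O) r := by
  obtain ⟨c, hc, hv⟩ := hv
  refine ⟨g * c, fun x hx => ?_, by rwa [dist_mul_left]⟩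
  have := hc _ (hg x hx)
  rwa [← dist_mul_left A g, mul_inv_cancel_left] at this

theorem isClique_ballAround_zero (hgen : Subgroup.closure A = ⊤) {δ : ℕ}
    (hδ : IsHyperbolicGraph (SimpleGraph.mulCayley A) δ) (hD : 8 * δ + 1 ≤ D) (hO : O.Nonempty) :
    (ripsGraph A D).IsClique
      (ballAround (SimpleGraph.mulCayley A) (quasiCentre (SimpleGraph.mulCayley A) O) 0) := by
  have hΓ := mulCayley_connected hgen
  rintro x ⟨c, hc, hx⟩ y ⟨c', hc', hy⟩ hxy
  obtain rfl := hΓ.dist_eq_zero_iff.1 (Nat.le_zero.1 hx)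
  obtain rfl := hΓ.dist_eq_zero_iff.1 (Nat.le_zero.1 hy)
  have := dist_le_of_mem_quasiCentre hΓ hδ hO hc hc'
  exact ⟨hxy, by omega⟩

theorem exists_ripsGraph_dominating (hgen : Subgroup.closure A = ⊤) {δ : ℕ}
    (hδ : IsHyperbolicGraph (SimpleGraph.mulCayley A) δ) (hD : 8 * δ + 1 ≤ D) (hO : O.Nonempty)
    {r : ℕ} {ρ : G}
    (hρ : ρ ∈ ballAround (SimpleGraph.mulCayley A) (quasiCentre (SimpleGraph.mulCayley A) O)
      (r + 1))
    (hρ' : ρ ∉ ballAround (SimpleGraph.mulCayley A) (quasiCentre (SimpleGraph.mulCayley A) O) r) :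
    ∃ π ∈ ballAround (SimpleGraph.mulCayley A) (quasiCentre (SimpleGraph.mulCayley A) O) r,
      ∀ σ ∈ ballAround (SimpleGraph.mulCayley A) (quasiCentre (SimpleGraph.mulCayley A) O) (r + 1),
        (σ = ρ ∨ (ripsGraph A D).Adj ρ σ) → (σ = π ∨ (ripsGraph A D).Adj π σ) := by
  have hΓ := mulCayley_connected hgen
  obtain ⟨π, hπ, h⟩ := exists_dominating_mem_ballAround hΓ hδ hD
    (fun c hc c' hc' => dist_le_of_mem_quasiCentre hΓ hδ hO hc hc') hρ hρ'
  exact ⟨π, hπ, fun σ hσ hρσ => eq_or_ripsGraph_adj_iff.2 (h σ hσ (eq_or_ripsGraph_adj_iff.1 hρσ))⟩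

theorem isDismantlableOn_ballAround (hfin : A.Finite) (hgen : Subgroup.closure A = ⊤) {δ : ℕ}
    (hδ : IsHyperbolicGraph (SimpleGraph.mulCayley A) δ) (hD : 8 * δ + 1 ≤ D) (hO : O.Nonempty)
    (hOfin : O.Finite) (r : ℕ) :
    IsDismantlableOn (ripsGraph A D)
      (ballAround (SimpleGraph.mulCayley A) (quasiCentre (SimpleGraph.mulCayley A) O) r) := by
  induction r with
  | zero =>
    obtain ⟨c, hc⟩ := quasiCentre_nonempty (Γ := SimpleGraph.mulCayley A) hOfin
    have hc0 : c ∈ ballAround (SimpleGraph.mulCayley A)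
        (quasiCentre (SimpleGraph.mulCayley A) O) 0 := ⟨c, hc, by simp⟩
    refine (isDismantlableOn_singleton c).of_subset (Set.singleton_subset_iff.2 hc0)
      -- The ball of radius `0` is a clique, so each of its vertices is dominated by `c`.
      (finite_ballAround_quasiCentre hfin hgen hO 0) fun ρ _ _ => ⟨c, rfl, fun σ hσ _ => ?_⟩
    by_cases h : σ = c
    · exact Or.inl h
    · exact Or.inr (isClique_ballAround_zero hgen hδ hD hO hc0 hσ (Ne.symm h))
  | succ r ih =>
    exact ih.of_subset (ballAround_mono _ (Nat.le_succ r))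
      (finite_ballAround_quasiCentre hfin hgen hO _)
      fun ρ hρ hρ' => exists_ripsGraph_dominating hgen hδ hD hO hρ hρ'

/-! ### The action on the Rips complex -/

theorem smul_realization_apply (g : G) (x : Realization (ripsComplex A D)) (v : G) :
    (g • x).1 v = x.1 (g⁻¹ * v) := rfl

theorem smul_realization_val (g : G) (x : Realization (ripsComplex A D)) :
    (g • x).1 = Finsupp.lmapDomain ℝ ℝ (Equiv.mulLeft g) x.1 :=
  Finsupp.equivMapDomain_eq_mapDomain _ _

instance : ContinuousConstSMul G (Realization (ripsComplex A D)) := by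
  refine ⟨fun g => continuous_realization_iff.2 fun s _ => ?_⟩
  refine continuous_of_support_subset (s.map (Equiv.mulLeft g).toEmbedding) (fun x v hv => ?_)
    fun v => continuous_closedSimplex_apply s (g⁻¹ * v)
  rw [Finset.mem_map_equiv]
  have hv' := Finsupp.mem_support_iff.1 hv
  exact x.2 (Finsupp.mem_support_iff.2 hv')

theorem fixedPoints_eq_empty_of_infinite (H : Subgroup G) [Infinite H] :
    MulAction.fixedPoints H (Realization (ripsComplex A D)) = ∅ := by
  refine Set.eq_empty_of_forall_notMem fun x hx => ?_
  obtain ⟨v, hv⟩ := x.2.1.1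
  have hmem : ∀ h : H, (h : G) * v ∈ x.1.support := by
    intro h
    have h1 : (h : G) • x = x := hx h
    rw [Finsupp.mem_support_iff] at hv ⊢
    rwa [← h1, smul_realization_apply, inv_mul_cancel_left]
  refine not_injective_infinite_finite (fun h : H => (⟨(h : G) * v, hmem h⟩ : x.1.support))
    fun h h' e => ?_
  exact Subtype.ext (mul_right_cancel (congrArg Subtype.val e))

theorem contractibleSpace_fixedPoints (hfin : A.Finite) (hgen : Subgroup.closure A = ⊤) {δ : ℕ}
    (hδ : IsHyperbolicGraph (SimpleGraph.mulCayley A) δ) (hD : 8 * δ + 1 ≤ D)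
    (H : Subgroup G) [Finite H] :
    ContractibleSpace (MulAction.fixedPoints H (Realization (ripsComplex A D))) := by
  have hΓ := mulCayley_connected hgen
  -- The exhaustion consists of the balls around the quasi-centre of `H`, a finite set invariant
  -- under left translation by `H`.
  have hO : (H : Set G).Nonempty := ⟨1, H.one_mem⟩
  have hOfin : (H : Set G).Finite := Set.toFinite _
  have hball := finite_ballAround_quasiCentre hfin hgen hO
  obtain ⟨c, hc⟩ := quasiCentre_nonempty (Γ := SimpleGraph.mulCayley A) hOfin
  have hinv : ∀ h ∈ H, ∀ r v, h * v ∈ ballAround (SimpleGraph.mulCayley A)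
      (quasiCentre (SimpleGraph.mulCayley A) (H : Set G)) r ↔ v ∈ ballAround
      (SimpleGraph.mulCayley A) (quasiCentre (SimpleGraph.mulCayley A) (H : Set G)) r := by
    intro h hh r v
    refine ⟨fun hv => ?_, mul_mem_ballAround_quasiCentre fun x hx => H.mul_mem (H.inv_mem hh) hx⟩
    simpa using mul_mem_ballAround_quasiCentre (g := h⁻¹)
      (fun x hx => by simpa using H.mul_mem hh hx) hv
  have key := contractibleSpace_of_dominators (Γ := ripsGraph A D) (T := fun r => (hball r).toFinset)
    (fun r s hrs => by simpa using ballAround_mono _ hrs)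
    (fun v => ⟨(SimpleGraph.mulCayley A).dist c v, by simpa using ⟨c, hc, le_rfl⟩⟩)
    (by simpa using ⟨c, c, hc, by simp⟩)
    (by simpa using isClique_ballAround_zero hgen hδ hD hO)
    (fun r v hv hv' => by
      rw [Set.Finite.mem_toFinset] at hv hv'
      obtain ⟨π, hπ, h⟩ := exists_ripsGraph_dominating hgen hδ hD hO hv hv'
      exact ⟨π, mem_dominators.2 ⟨by simpa using hπ, fun σ hσ => h σ (by simpa using hσ)⟩⟩)
    {e | ∃ h ∈ H, e = Equiv.mulLeft h}
    (by
      rintro _ ⟨h, -, rfl⟩ v w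
      exact ripsGraph_adj_mul_left h v w)
    (by
      rintro _ ⟨h, hh, rfl⟩ r v
      simpa using hinv h hh r v)
  have hset : MulAction.fixedPoints H (Realization (ripsComplex A D)) =
      {x : Realization (flagComplex (ripsGraph A D)) |
        ∀ e ∈ {e | ∃ h ∈ H, e = Equiv.mulLeft h}, Finsupp.lmapDomain ℝ ℝ e x.1 = x.1} := by
    ext x
    constructor
    · rintro hx _ ⟨h, hh, rfl⟩
      exact (smul_realization_val h x).symm.trans (congrArg Subtype.val (hx ⟨h, hh⟩))
    · intro hx h
      exact Subtype.ext ((smul_realization_val (h : G) x).trans (hx _ ⟨h, h.2, rfl⟩))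
  rw [hset]
  exact key

/-! ### The action on the cells of the barycentric subdivision -/

/-- The translate of a chain of finite sets. -/
def translateChain (g : G) (c : Finset (Finset G)) : Finset (Finset G) :=
  c.map (Finset.mapEmbedding (Equiv.mulLeft g).toEmbedding).toEmbedding

theorem mem_translateChain {g : G} {c : Finset (Finset G)} {t : Finset G} :
    t ∈ translateChain g c ↔ ∃ s ∈ c, s.map (Equiv.mulLeft g).toEmbedding = t := by
  simp [translateChain]

theorem map_mulLeft_map_mulLeft (g h : G) (s : Finset G) :
    (s.map (Equiv.mulLeft h).toEmbedding).map (Equiv.mulLeft g).toEmbedding =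
      s.map (Equiv.mulLeft (g * h)).toEmbedding := by
  rw [Finset.map_map]
  congr 1
  ext x
  simp [mul_assoc]

theorem map_mulLeft_one (s : Finset G) : s.map (Equiv.mulLeft (1 : G)).toEmbedding = s := by
  rw [Equiv.mulLeft_one]
  exact Finset.map_refl

theorem translateChain_inv_translateChain (g : G) (c : Finset (Finset G)) :
    translateChain g⁻¹ (translateChain g c) = c := by
  ext t
  simp only [mem_translateChain, exists_exists_and_eq_and, map_mulLeft_map_mulLeft,
    inv_mul_cancel, map_mulLeft_one, exists_eq_right]

theorem smul_mem_openChainCell (g : G) {c : Finset (Finset G)}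
    {x : Realization (ripsComplex A D)} (hx : x ∈ openChainCell (ripsComplex A D) c) :
    g • x ∈ openChainCell (ripsComplex A D) (translateChain g c) := by
  obtain ⟨w, hw, h1, hx⟩ := hx
  have hws : ∀ s : Finset G, w ((s.map (Equiv.mulLeft g).toEmbedding).map
      (Equiv.mulLeft g⁻¹).toEmbedding) = w s := fun s => by
    rw [map_mulLeft_map_mulLeft, inv_mul_cancel, map_mulLeft_one]
  refine ⟨fun t => w (t.map (Equiv.mulLeft g⁻¹).toEmbedding), ?_, ?_, ?_⟩
  · intro t ht
    obtain ⟨s, hs, rfl⟩ := mem_translateChain.1 ht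
    exact (hw s hs).trans_eq (hws s).symm
  · rw [translateChain, Finset.sum_map, ← h1]
    exact Finset.sum_congr rfl fun s _ => hws s
  · rw [smul_realization_val, hx, chainSum, chainSum, translateChain, Finset.sum_map, map_sum]
    refine Finset.sum_congr rfl fun s _ => ?_
    rw [map_smul, lmapDomain_barycentre]
    exact congrArg (· • _) (hws s).symm

theorem image_smul_openChainCell (g : G) (c : Finset (Finset G)) :
    (fun x => g • x) '' openChainCell (ripsComplex A D) c =
      openChainCell (ripsComplex A D) (translateChain g c) := by
  refine Set.Subset.antisymm ?_ fun x hx => ⟨g⁻¹ • x, ?_, smul_inv_smul g x⟩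
  · rintro _ ⟨x, hx, rfl⟩
    exact smul_mem_openChainCell g hx
  · have := smul_mem_openChainCell g⁻¹ hx
    rwa [translateChain_inv_translateChain] at this

namespace ChainCell

variable {n : ℕ}

/-- The translate of a cell of the barycentric subdivision. -/
def translate (g : G) (c : ChainCell (ripsComplex A D) n) : ChainCell (ripsComplex A D) n := by
  refine ⟨translateChain g c.1, (Finset.card_map _).trans c.2.1, ?_, ?_⟩
  · rintro _ ht _ ht' _
    obtain ⟨s, hs, rfl⟩ := mem_translateChain.1 ht
    obtain ⟨s', hs', rfl⟩ := mem_translateChain.1 ht'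
    exact (c.2.2.1.total hs hs').imp Finset.map_subset_map.2 Finset.map_subset_map.2
  · intro t ht
    obtain ⟨s, hs, rfl⟩ := mem_translateChain.1 ht
    exact map_mem_ripsComplex A D g (c.2.2.2 s hs)

/-- A translate of a member `s` has the cardinality of `s`. If it is again in the chain, it is
comparable to `s` and thus equal to it, so every barycentre in the sum is fixed. -/
theorem smul_eq_of_translateChain_eq (c : ChainCell (ripsComplex A D) n) {g : G}
    (hg : translateChain g c.1 = c.1) {x : Realization (ripsComplex A D)}
    (hx : x ∈ openChainCell (ripsComplex A D) c.1) : g • x = x := by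
  obtain ⟨w, -, -, hx⟩ := hx
  apply Subtype.ext
  rw [smul_realization_val, hx, chainSum, map_sum]
  refine Finset.sum_congr rfl fun s hs => ?_
  have hgs : s.map (Equiv.mulLeft g).toEmbedding ∈ c.1 := by
    exact hg.subset (mem_translateChain.2 ⟨s, hs, rfl⟩)
  have hcard := s.card_map (Equiv.mulLeft g).toEmbedding
  have : s.map (Equiv.mulLeft g).toEmbedding = s := by
    rcases c.2.2.1.total hgs hs with h | h
    · exact Finset.eq_of_subset_of_card_le h hcard.ge
    · exact (Finset.eq_of_subset_of_card_le h hcard.le).symm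
  rw [map_smul, lmapDomain_barycentre, this]

theorem exists_mem_forall_mem (c : ChainCell (ripsComplex A D) n) : ∃ v, ∀ s ∈ c.1, v ∈ s := by
  have hne : c.1.Nonempty := by
    rw [← Finset.card_pos, c.2.1]
    exact Nat.succ_pos n
  obtain ⟨s, hs, hmin⟩ := Finset.exists_min_image c.1 Finset.card hne
  obtain ⟨v, hv⟩ := c.nonempty_of_mem s hs
  refine ⟨v, fun t ht => ?_⟩
  rcases c.2.2.1.total hs ht with h | h
  · exact h hv
  · exact (Finset.eq_of_subset_of_card_le h (hmin t ht)).symm ▸ hv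

theorem nonempty_openChainCell (c : ChainCell (ripsComplex A D) n) :
    (openChainCell (ripsComplex A D) c.1).Nonempty := by
  rw [← c.image_charMap_ball]
  exact ⟨_, 0, Metric.mem_ball_self one_pos, rfl⟩

end ChainCell

theorem isGCWStructure_subdivisionCW :
    IsGCWStructure G (subdivisionCW (ripsComplex A D)) := by
  refine ⟨fun g n c => ⟨ChainCell.translate g c, ?_⟩, fun g n c hg x hx => ?_⟩
  · rw [openCell_subdivisionCW, openCell_subdivisionCW]
    exact image_smul_openChainCell g _
  · rw [openCell_subdivisionCW] at hg hx
    refine ChainCell.smul_eq_of_translateChain_eq c ?_ hx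
    obtain ⟨y, hy⟩ := ChainCell.nonempty_openChainCell c
    have hy' : y ∈ openChainCell (ripsComplex A D) (ChainCell.translate g c).1 :=
      (image_smul_openChainCell g _).subset (hg.superset hy)
    exact ChainCell.eq_of_mem_openChainCell hy' hy

theorem isCofinite_subdivisionCW (hfin : A.Finite) (hgen : Subgroup.closure A = ⊤) :
    IsCofinite G (subdivisionCW (ripsComplex A D)) := by
  have hB := finite_dist_le hfin hgen 1 D
  refine ⟨{p | p.2.1 ⊆ hB.toFinset.powerset}, ?_, fun n c => ?_⟩
  · refine Set.Finite.of_finite_image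
      (f := fun p : Σ n, ChainCell (ripsComplex A D) n => p.2.1)
      (hB.toFinset.powerset.powerset.finite_toSet.subset ?_)
      fun p _ q _ h => ChainCell.sigma_ext h
    rintro _ ⟨p, hp, rfl⟩
    exact Finset.mem_coe.2 (Finset.mem_powerset.2 hp)
  · obtain ⟨v, hv⟩ := ChainCell.exists_mem_forall_mem c
    -- Here `v` lies in every member of `c`. Translation by `v⁻¹` moves it to `1`, and cliques of
    -- the Rips graph containing `1` lie in the ball of radius `D` around `1`.
    refine ⟨⟨n, ChainCell.translate v⁻¹ c⟩, fun t ht => ?_, v, ?_⟩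
    · obtain ⟨s, hs, rfl⟩ := mem_translateChain.1 ht
      rw [Finset.mem_powerset]
      intro x hx
      rw [Finset.mem_map_equiv] at hx
      have hvs := eq_or_ripsGraph_adj_iff.1 (or_iff_not_imp_left.2 fun hne =>
        (c.2.2.2 s hs).2 (hv s hs) hx (Ne.symm hne))
      rw [← dist_mul_left A v⁻¹] at hvs
      simpa using hvs
    · rw [openCell_subdivisionCW, openCell_subdivisionCW]
      refine ((image_smul_openChainCell v _).trans ?_).symm
      congr 1
      have := translateChain_inv_translateChain v⁻¹ c.1
      rwa [inv_inv] at this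

/-! ### The two claims for the Rips complex -/

theorem isFiniteModelProperActions_ripsComplex (hfin : A.Finite)
    (hgen : Subgroup.closure A = ⊤) {δ : ℕ}
    (hδ : IsHyperbolicGraph (SimpleGraph.mulCayley A) δ) (hD : 8 * δ + 1 ≤ D) :
    IsFiniteModelProperActions G (Realization (ripsComplex A D)) where
  continuous_smul := inferInstance
  hausdorff := inferInstance
  exists_gcw := ⟨subdivisionCW _, isGCWStructure_subdivisionCW, isCofinite_subdivisionCW hfin hgen⟩
  contractible_fixedPoints H _ := contractibleSpace_fixedPoints hfin hgen hδ hD H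
  fixedPoints_eq_empty H _ := fixedPoints_eq_empty_of_infinite H

theorem exists_dismantlable_ballAround (hfin : A.Finite) (hgen : Subgroup.closure A = ⊤) {δ : ℕ}
    (hδ : IsHyperbolicGraph (SimpleGraph.mulCayley A) δ) (hD : 8 * δ + 1 ≤ D)
    (H : Subgroup G) [Finite H] {S : Set G} (hS : S.Finite) (hne : S.Nonempty) :
    ∃ r : ℕ, ∃ T : Set G, T = ballAround (SimpleGraph.mulCayley A)
      (quasiCentre (SimpleGraph.mulCayley A) {x | ∃ h ∈ H, ∃ s ∈ S, x = h * s}) r ∧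
      T.Finite ∧ S ⊆ T ∧ (∀ h ∈ H, ∀ x ∈ T, h * x ∈ T) ∧
      IsDismantlableOn (ripsGraph A D) T := by
  have hO : {x | ∃ h ∈ H, ∃ s ∈ S, x = h * s}.Nonempty := by
    obtain ⟨s, hs⟩ := hne
    exact ⟨1 * s, 1, H.one_mem, s, hs, rfl⟩
  have hOfin : {x | ∃ h ∈ H, ∃ s ∈ S, x = h * s}.Finite := by
    refine ((Set.toFinite (H : Set G)).image2 (· * ·) hS).subset ?_
    rintro x ⟨h, hh, s, hs, rfl⟩
    exact ⟨h, hh, s, hs, rfl⟩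
  obtain ⟨c, hc⟩ := quasiCentre_nonempty (Γ := SimpleGraph.mulCayley A) hOfin
  obtain ⟨r, hr⟩ := (hS.image ((SimpleGraph.mulCayley A).dist c)).bddAbove
  refine ⟨r, _, rfl, finite_ballAround_quasiCentre hfin hgen hO r,
    fun s hs => ⟨c, hc, hr ⟨s, hs, rfl⟩⟩, fun h hh x hx => ?_,
    isDismantlableOn_ballAround hfin hgen hδ hD hO hOfin r⟩
  refine mul_mem_ballAround_quasiCentre ?_ hx
  rintro _ ⟨h', hh', s, hs, rfl⟩
  exact ⟨h⁻¹ * h', H.mul_mem (H.inv_mem hh) hh', s, hs, (mul_assoc _ _ _).symm⟩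

end Rips

end RipsModel

theorem theorem1p5 {G : Type*} [Group G] (A : Set G) (hfin : A.Finite)
    (hgen : Subgroup.closure A = ⊤) (δ D : ℕ)
    (hδ : RipsModel.IsHyperbolicGraph (SimpleGraph.mulCayley A) δ) (hD : 8 * δ + 1 ≤ D) :
    RipsModel.IsFiniteModelProperActions G
        (RipsModel.Realization (RipsModel.ripsComplex A D)) ∧
      ∀ H : Subgroup G, Finite H → ∀ S : Set G, S.Finite →
        ∃ T : Set G, T.Finite ∧ S ⊆ T ∧ (∀ h ∈ H, ∀ x ∈ T, h * x ∈ T) ∧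
          RipsModel.IsDismantlableOn (RipsModel.ripsGraph A D) T ∧
          (S.Nonempty → ∃ r : ℕ, T = RipsModel.ballAround (SimpleGraph.mulCayley A)
            (RipsModel.quasiCentre (SimpleGraph.mulCayley A)
              {x | ∃ h ∈ H, ∃ s ∈ S, x = h * s}) r) := by
  refine ⟨RipsModel.isFiniteModelProperActions_ripsComplex hfin hgen hδ hD, fun H _ S hS => ?_⟩
  rcases S.eq_empty_or_nonempty with rfl | hne
  -- The orbit of the empty set is empty, so the ball is built for the set `{1}` instead.
  · obtain ⟨r, T, -, h1, -, h2, h3⟩ := RipsModel.exists_dismantlable_ballAround hfin hgen hδ hD H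
      (Set.finite_singleton (1 : G)) (Set.singleton_nonempty 1)
    exact ⟨T, h1, Set.empty_subset T, h2, h3, fun h => absurd h Set.not_nonempty_empty⟩
  · obtain ⟨r, T, hT, h1, h2, h3, h4⟩ :=
      RipsModel.exists_dismantlable_ballAround hfin hgen hδ hD H hS hne
    exact ⟨T, h1, h2, h3, h4, fun _ => ⟨r, hT⟩⟩
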